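/- \textbf{The game.} Let $G=(V,E)$ be a finite, connected, simple graph and let $N\ge 3$. There are $N$ tokens on vertices of $G$: cops $C_1,\dots,C_{N-1}$ and a robber $R$ (token $N$). A state $s=(x^1,\dots,x^N,n)$ consists of the locations of the tokens and of the token $n$ that moves next; then token $n$ moves to a neighbouring vertex or stays put, and the turn passes on in the cyclic order $C_1,\dots,C_{N-1},R,C_1,\dots$. A state is a capture state if some cop is on the vertex of the robber; $S_{nc}$ is the set of noncapture states, and $S^n$ is the set of states in which token $n$ has the move. The capture time $t$ is the first time at which a capture state occurs; the game is then over. A (pure) strategy maps finite histories to moves; it is positional if the move depends only on the current state. \textbf{Zero-sum games.} Let $\gamma\in(0,1)$ and $\varepsilon=0$. In $\Gamma_N^m$ player $P_m$ controls token $m$ and his opponent $P_{-m}$ controls all other tokens. If capture occurs at time $t$, the payoff of $P_N$ in $\Gamma^N_N$ is $-\gamma^t$, and for $m<N$ the payoff of $P_m$ in $\Gamma_N^m$ is $\gamma^t/K$ if exactly $K$ cops, $C_m$ among them, are then on the robber's vertex, and $0$ if $C_m$ is not on it. Without capture the payoff is $0$. Optimal strategies in $\Gamma_N^m$ are positional strategies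 that guarantee the value of the game from every initial state; a strategy of a token other than $m$ is a component of an optimal joint strategy of $P_{-m}$. Let $\widehat\Sigma^n$ be the set of CR-optimal strategies of token $n$, i.e. of its optimal strategies in $\Gamma^N_N$. If under every profile of CR-optimal strategies cop $C_m$ effects the capture when the game starts at $s$, write $\widehat C(s)=C_m$. \textbf{State cop number and classes of graphs.} For $s\in S_{nc}$, $c(G|s)$ is the least $k\in\{1,\dots,N-1\}$ such that some $k$ cops have strategies with which capture (by any cop) occurs from $s$ whatever the other $N-k$ tokens do, and $c(G|s)=\infty$ if there is no such $k$. Given $N$, let $\mathcal G$ be the class of those $G$ with $c(G|s)=\infty$ for some $s\in S_{nc}$; $\mathcal G_1$ the class of $G\in\mathcal G$ with $c(G|s)\in\{2,\dots,N-1\}$ for some $s\in S_{nc}$; $\mathcal G_1'=\mathcal G\setminus\mathcal G_1$; $\mathcal G_2$ the class of $G\in\mathcal G$ with $c(G|s)=\infty$ for all $s\in S^N\cap S_{nc}$; and $\mathcal G_2'=\mathcal G_1'\setminus\mathcal G_2$. Let $\mathcal G_3$ be the class of those $G\in\mathcal G_2'$ such that for every $s\in S_{nc}$ with $c(G|s)=1$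 the cop $C_m=\widehat C(s)$ has a CR-optimal strategy $\widehat\sigma^m$ such that, from $s$, whatever strategies $\sigma^{-m}$ the other tokens use, $(\widehat\sigma^m,\sigma^{-m})$ leads to a capture in which $C_m$ takes part. \textbf{Trigger strategies.} A trigger strategies profile $\overline\sigma=(\overline\sigma^1,\dots,\overline\sigma^N)$ is composed of a family $(\phi_m^n)_{m,n}$ such that, for every $m$, $\phi_m^m$ and $(\phi_m^n)_{n\ne m}$ are optimal strategies of $P_m$ and $P_{-m}$ in $\Gamma_N^m$: $\overline\sigma^n$ follows $\phi_n^n$ as long as every player $m\neq n$ follows $\phi_m^m$, and follows $\phi_m^n$ as soon as some player $m\ne n$ has deviated from $\phi_m^m$ ($m$ being the first such player). \textbf{Proposition.} Let $N\ge3$, $G\in\mathcal G_3$, $\gamma\in(0,1)$, $\varepsilon=0$ and $s_0\in S_{nc}$. \begin{enumerate} \item There is a trigger strategies profile that is positional in the game started at $s_0$, in the sense that for all $n,m\in\{1,\dots,N\}$ there is $\widehat\sigma^n\in\widehat\Sigma^n$ with $\phi_m^n(s)=\widehat\sigma^n(s)$ for every state $s\in S^n$ at the end of a finite history of noncapture states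 starting at $s_0$, if and only if $\gamma\in\left(0,\frac1{N-1}\right]$. \item There is a trigger strategies profile all of whose strategies $\overline\sigma^n$ are positional on the finite histories of noncapture states (with arbitrary initial state) if and only if $\gamma\in\left(0,\frac1{N-1}\right]$. \end{enumerate} -/

import Mathlib

/-!
Selfish cops and adversarial robber: a game with `c` cops and one robber, hence `N = c + 1` tokens.
The tokens are the elements of `Fin (c + 1)`; the cops are `Fin.castSucc i` for `i : Fin c`, and
the robber is `Fin.last c`.
-/

namespace Scar

/-- A state: the location of every token, and the token that moves next. -/
@[ext]
structure State (V : Type*) (c : ℕ) where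
  pos : Fin (c + 1) → V
  turn : Fin (c + 1)

/-- The vertex of the robber. -/
def State.robber {V : Type*} {c : ℕ} (s : State V c) : V := s.pos (Fin.last c)

/-- Capture states: at least one cop is on the vertex of the robber. -/
def State.IsCapture {V : Type*} {c : ℕ} (s : State V c) : Prop :=
  ∃ i : Fin c, s.pos i.castSucc = s.robber

/-- The state after the token with the move goes to `v`. Addition in `Fin (c + 1)` is cyclic, so
that the order of play is `C₁, …, C_{N-1}, R, C₁, …`. -/
def State.step {V : Type*} {c : ℕ} (s : State V c) (v : V) : State V c :=
  ⟨Function.update s.pos s.turn v, s.turn + 1⟩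

/-- A token may stay where it is or go to a neighbouring vertex. -/
def Legal {V : Type*} (G : SimpleGraph V) (u v : V) : Prop := v = u ∨ G.Adj u v

/-- A pure strategy of token `n`: a map from finite histories to next moves. A history is given
by the list of its past states, the most recent one first, and its current state. Only the moves
at states in which `n` has the turn matter. -/
structure Strategy {V : Type*} (G : SimpleGraph V) (c : ℕ) (n : Fin (c + 1)) where
  move : List (State V c) → State V c → V
  legal : ∀ h s, s.turn = n → Legal G (s.pos n) (move h s)

/-- A positional pure strategy of token `n`. -/
structure PosStrategy {V : Type*} (G : SimpleGraph V) (c : ℕ) (n : Fin (c + 1)) where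
  move : State V c → V
  legal : ∀ s, s.turn = n → Legal G (s.pos n) (move s)

/-- A positional strategy as a strategy. -/
def PosStrategy.toStrategy {V : Type*} {G : SimpleGraph V} {c : ℕ} {n : Fin (c + 1)}
    (σ : PosStrategy G c n) : Strategy G c n :=
  ⟨fun _ s => σ.move s, fun _ s hs => σ.legal s hs⟩

/-- Strategy profiles. -/
abbrev Profile {V : Type*} (G : SimpleGraph V) (c : ℕ) : Type _ := ∀ n, Strategy G c n

/-- Profiles of positional strategies. -/
abbrev PosProfile {V : Type*} (G : SimpleGraph V) (c : ℕ) : Type _ := ∀ n, PosStrategy G c n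

/-- A profile of positional strategies as a profile. -/
def PosProfile.toProfile {V : Type*} {G : SimpleGraph V} {c : ℕ} (σ : PosProfile G c) :
    Profile G c := fun n => (σ n).toStrategy

/-- The history after `t` turns when the game starts at `s` and the profile `σ` is played. What
happens after the first capture state is immaterial for all notions below, so that no separate
terminal state is needed. -/
def run {V : Type*} {G : SimpleGraph V} {c : ℕ} (σ : Profile G c) (s : State V c) :
    ℕ → List (State V c) × State V c
  | 0 => ([], s)
  | t + 1 => ((run σ s t).2 :: (run σ s t).1,
      (run σ s t).2.step ((σ (run σ s t).2.turn).move (run σ s t).1 (run σ s t).2))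

/-- The state after `t` turns. -/
def stateAt {V : Type*} {G : SimpleGraph V} {c : ℕ} (σ : Profile G c) (s : State V c) (t : ℕ) :
    State V c := (run σ s t).2

/-- From `s`, the profile `σ` leads to capture. -/
def LeadsToCapture {V : Type*} {G : SimpleGraph V} {c : ℕ} (σ : Profile G c) (s : State V c) :
    Prop := ∃ t, (stateAt σ s t).IsCapture

/-- `t` is the capture time: the first time at which a capture state occurs. -/
def IsCaptureTime {V : Type*} {G : SimpleGraph V} {c : ℕ} (σ : Profile G c) (s : State V c)
    (t : ℕ) : Prop :=
  (stateAt σ s t).IsCapture ∧ ∀ t' < t, ¬ (stateAt σ s t').IsCapture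

/-- From `s`, the profile `σ` leads to a capture by cop `m`, possibly jointly with other cops:
at the capture time cop `m` is on the vertex of the robber. -/
def LeadsToCaptureBy {V : Type*} {G : SimpleGraph V} {c : ℕ} (σ : Profile G c) (s : State V c)
    (m : Fin c) : Prop :=
  ∃ t, IsCaptureTime σ s t ∧ (stateAt σ s t).pos m.castSucc = (stateAt σ s t).robber

/-- The number `K` of cops on the vertex of the robber. -/
noncomputable def State.numCapturing {V : Type*} {c : ℕ} (s : State V c) : ℕ :=
  Nat.card {i : Fin c // s.pos i.castSucc = s.robber}

open Classical in
/-- The coefficient of `γ ^ t` in the payoff of player `P_m` in the zero-sum game `Γ_N^m`, when the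
capture state `s` ends the game. Here `c = N - 1`. -/
noncomputable def reward {V : Type*} {c : ℕ} (ε : ℝ) (m : Fin (c + 1)) (s : State V c) : ℝ :=
  if m = Fin.last c then -1
  else if s.numCapturing = c then 1 / (c : ℝ)
  else if s.pos m = s.robber then (1 - ε) / (s.numCapturing : ℝ)
  else ε / ((c : ℝ) - (s.numCapturing : ℝ))

open Classical in
/-- The payoff of player `P_m` in the zero-sum game `Γ_N^m(G | s, γ, ε)`, in which `P_m` controls
token `m` and his opponent `P_{-m}` controls all other tokens. -/
noncomputable def payoff {V : Type*} {G : SimpleGraph V} {c : ℕ} (γ ε : ℝ) (m : Fin (c + 1))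
    (s : State V c) (σ : Profile G c) : ℝ :=
  if h : ∃ t, (stateAt σ s t).IsCapture then
    reward ε m (stateAt σ s (Nat.find h)) * γ ^ Nat.find h
  else 0

/-- The payoff of `P_m` when `P_m` uses `α` and `P_{-m}` uses the components of `ρ` other than
the `m`-th one. -/
noncomputable def posPayoff {V : Type*} {G : SimpleGraph V} {c : ℕ} (γ ε : ℝ) (m : Fin (c + 1))
    (s : State V c) (α : PosStrategy G c m) (ρ : PosProfile G c) : ℝ :=
  payoff γ ε m s (PosProfile.toProfile (Function.update ρ m α))

/-- The value of `Γ_N^m(G | s, γ, ε)`. -/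
noncomputable def value {V : Type*} (G : SimpleGraph V) {c : ℕ} (γ ε : ℝ) (m : Fin (c + 1))
    (s : State V c) : ℝ :=
  ⨆ α : PosStrategy G c m, ⨅ ρ : PosProfile G c, posPayoff γ ε m s α ρ

/-- `φ` consists of optimal positional strategies of both players in the games
`Γ_N^m(G | s, γ, ε)`, for all initial states `s`: the component `φ m` guarantees the value to `P_m`,
and the other components together guarantee the value to `P_{-m}`. -/
def IsOptimalProfile {V : Type*} {G : SimpleGraph V} {c : ℕ} (γ ε : ℝ) (m : Fin (c + 1))
    (φ : PosProfile G c) : Prop :=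
  (∀ s (ρ : PosProfile G c), value G γ ε m s ≤ posPayoff γ ε m s (φ m) ρ) ∧
  (∀ s (α : PosStrategy G c m), posPayoff γ ε m s α φ ≤ value G γ ε m s)

/-- CR-optimal strategies of token `n`: optimal positional strategies for that token in the
modified cops and robber game `Γ_N^N`. -/
def IsCROptimal {V : Type*} {G : SimpleGraph V} {c : ℕ} (γ ε : ℝ) {n : Fin (c + 1)}
    (σ : PosStrategy G c n) : Prop :=
  ∃ φ : PosProfile G c, IsOptimalProfile γ ε (Fin.last c) φ ∧ φ n = σ

/-- A CR-optimal profile: every component is CR-optimal. -/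
def IsCROptimalProfile {V : Type*} {G : SimpleGraph V} {c : ℕ} (γ ε : ℝ)
    (σ : PosProfile G c) : Prop :=
  ∀ n, IsCROptimal γ ε (σ n)

/-- `Ĉ(s) = C_m`: cop `m` effects the capture under every CR-optimal profile when the game starts
at `s`. -/
def IsCapturer {V : Type*} (G : SimpleGraph V) {c : ℕ} (γ ε : ℝ) (s : State V c) (m : Fin c) :
    Prop :=
  ∀ σ : PosProfile G c, IsCROptimalProfile γ ε σ → LeadsToCaptureBy σ.toProfile s m

/-- The strategies of the cops in `I` under `σ` guarantee capture from `s`, whatever the other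
tokens do. -/
def IsGuaranteedCapture {V : Type*} {G : SimpleGraph V} {c : ℕ} (s : State V c)
    (I : Finset (Fin c)) (σ : ∀ i : Fin c, Strategy G c i.castSucc) : Prop :=
  ∀ ρ : Profile G c, (∀ i ∈ I, ρ i.castSucc = σ i) → LeadsToCapture ρ s

/-- The state cop number `c(G | s)`: the least number `k ≥ 1` of cops that have a guaranteed
capture profile from `s`, and `⊤` if there is none. -/
noncomputable def stateCopNumber {V : Type*} (G : SimpleGraph V) {c : ℕ} (s : State V c) : ℕ∞ :=
  sInf {k : ℕ∞ | ∃ I : Finset (Fin c), I.Nonempty ∧ k = (I.card : ℕ∞) ∧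
    ∃ σ : ∀ i : Fin c, Strategy G c i.castSucc, IsGuaranteedCapture s I σ}

/-- The class `𝒢(N)` with `N = c + 1`: the cops do not suffice from some state. -/
def ClassG {V : Type*} (G : SimpleGraph V) (c : ℕ) : Prop :=
  ∃ s : State V c, ¬ s.IsCapture ∧ stateCopNumber G s = ⊤

/-- The class `𝒢₁`. -/
def ClassG1 {V : Type*} (G : SimpleGraph V) (c : ℕ) : Prop :=
  ClassG G c ∧ ∃ s : State V c, ¬ s.IsCapture ∧
    ∃ k : ℕ, 2 ≤ k ∧ k ≤ c ∧ stateCopNumber G s = (k : ℕ∞)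

/-- The class `𝒢₁' = 𝒢 \ 𝒢₁`. -/
def ClassG1' {V : Type*} (G : SimpleGraph V) (c : ℕ) : Prop :=
  ClassG G c ∧ ¬ ClassG1 G c

/-- The class `𝒢₂`: at every noncapture state in which the robber has the move, he can evade. -/
def ClassG2 {V : Type*} (G : SimpleGraph V) (c : ℕ) : Prop :=
  ClassG G c ∧ ∀ s : State V c, ¬ s.IsCapture → s.turn = Fin.last c → stateCopNumber G s = ⊤

/-- The class `𝒢₂' = 𝒢₁' \ 𝒢₂`. -/
def ClassG2' {V : Type*} (G : SimpleGraph V) (c : ℕ) : Prop :=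
  ClassG1' G c ∧ ¬ ClassG2 G c

/-- The class `𝒢₃`: at every noncapture state `s` with `c(G | s) = 1`, the cop `Ĉ(s)` has a
CR-optimal strategy with which it effects capture, no matter what the other tokens do. The
parameters `γ ∈ (0, 1)` and `ε` enter only through the payoff `-γ ^ t` that defines
CR-optimality. -/
def ClassG3 {V : Type*} (G : SimpleGraph V) (c : ℕ) (γ ε : ℝ) : Prop :=
  ClassG2' G c ∧ ∀ s : State V c, ¬ s.IsCapture → stateCopNumber G s = 1 →
    ∀ m : Fin c, IsCapturer G γ ε s m →
      ∃ τ : PosStrategy G c m.castSucc, IsCROptimal γ ε τ ∧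
        ∀ ρ : Profile G c, ρ m.castSucc = τ.toStrategy → LeadsToCaptureBy ρ s m

/-- `NCHistory G s₀ h s`: the past states `h` (most recent first) followed by the current state `s`
form a finite history that starts at `s₀`, obeys the rules of movement and consists of noncapture
states. -/
inductive NCHistory {V : Type*} (G : SimpleGraph V) {c : ℕ} (s₀ : State V c) :
    List (State V c) → State V c → Prop
  | start : ¬ s₀.IsCapture → NCHistory G s₀ [] s₀
  | move {h : List (State V c)} {s : State V c} (v : V) : NCHistory G s₀ h s →
      Legal G (s.pos s.turn) v → ¬ (s.step v).IsCapture → NCHistory G s₀ (s :: h) (s.step v)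

/-- A family `φ = (φ_m^n)`, with `φ_m^n` written `φ m n`, from which a trigger strategies profile is
composed: for every `m`, the strategies `φ m n` are optimal in the zero-sum game `Γ_N^m`. -/
def IsTriggerFamily {V : Type*} {G : SimpleGraph V} {c : ℕ} (γ ε : ℝ)
    (φ : Fin (c + 1) → PosProfile G c) : Prop :=
  ∀ m, IsOptimalProfile γ ε m (φ m)

open Classical in
/-- The first player `m ≠ n` who deviates from `φ_m^m` in a history, if there is one. -/
noncomputable def firstDeviator {V : Type*} {G : SimpleGraph V} {c : ℕ}
    (φ : Fin (c + 1) → PosProfile G c) (n : Fin (c + 1)) :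
    List (State V c) → State V c → Option (Fin (c + 1))
  | [], _ => none
  | x :: h, s =>
    match firstDeviator φ n h x with
    | some m => some m
    | none =>
      if x.turn ≠ n ∧ s.pos x.turn ≠ (φ x.turn x.turn).move x then some x.turn else none

/-- The trigger strategy of token `n`: follow `φ_n^n` as long as every other player `m` follows
`φ_m^m`, and follow `φ_m^n` as soon as some other player `m` has deviated from `φ_m^m`. -/
noncomputable def trigger {V : Type*} {G : SimpleGraph V} {c : ℕ}
    (φ : Fin (c + 1) → PosProfile G c) : Profile G c := fun n =>
  { move := fun h s => (φ ((firstDeviator φ n h s).getD n) n).move s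
    legal := fun _ s hs => (φ _ n).legal s hs }

/-- A profile is positional: at every noncapture history, the next move depends only on the
current state. -/
def IsPositional {V : Type*} {G : SimpleGraph V} {c : ℕ} (σ : Profile G c) : Prop :=
  ∀ n, ∃ f : State V c → V, ∀ s₀ h s, NCHistory G s₀ h s → s.turn = n → (σ n).move h s = f s

/-- The criterion for positionality of a trigger strategies profile in the game started at `s₀`:
every `φ_m^n` agrees with a CR-optimal strategy of token `n` at the end of every noncapture history
that starts at `s₀` and after which `n` has the move. -/
def AgreesWithCROptimal {V : Type*} {G : SimpleGraph V} {c : ℕ} (γ ε : ℝ) (s₀ : State V c)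
    (φ : Fin (c + 1) → PosProfile G c) : Prop :=
  ∀ n m, ∃ σ : PosStrategy G c n, IsCROptimal γ ε σ ∧
    ∀ h s, NCHistory G s₀ h s → s.turn = n → (φ m n).move s = σ.move s

end Scar

/-! ### Elementary facts about single moves -/

namespace Scar

variable {V : Type*} {G : SimpleGraph V} {c : ℕ}

/-! CR-optimal strategies are greedy: cops shorten and the robber prolongs the number of turns in
which all cops together can force capture. Under greedy play this rank drops by one per turn, so
from a noncapture state where capture can be forced it determines whose move is the last one. That
cop, the finisher, is the cop Ĉ(s) (`IsFinisher.isCapturer`).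

The class 𝒢₃ says that the finisher takes part in the capture whatever the others do. This is very
restrictive. The other cops may be put on any neighbour of the robber without spoiling the
finisher's pursuit, and the robber may walk into them. Hence, if the robber has the move and cannot
escape, he is at a leaf (`Guarantees.exists_isLeafAt`), and the finisher is at the neighbour w of
the leaf or adjacent to w (`Guarantees.legal_of_isLeafAt`). Counting turns, the finisher alone is as
fast as all cops together (`IsFinisher.catchesWithin`).

In the game of the finisher, his opponents can therefore do only one harmful thing: the robber steps
onto him where other cops may stand, and the reward is shared. This yields at least γ/c, against at
least γ² for an undisturbed capture forgone. If γ ≤ 1/c the sharing does not pay, so a single greedy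
profile is optimal in all games at once (`isOptimalProfile_of_greedy`), and the trigger strategies
built from it never change behaviour.

If γ > 1/c, gather all cops at w with the robber to move at the leaf. A CR-optimal robber stays, but
in the game of the first cop he must surrender to all cops (`IsOptimalProfile.move_gathered`). The
second claim fails because this state ends both a history with a deviation of that cop and a history
without one. For the first claim the state must be reachable from `s₀` without capture. A connected
graph with a leaf on which the robber can escape has a vertex with three neighbours, where the
tokens can pass each other as in a shunting yard (`reaches_trap`). -/

theorem Legal.refl (u : V) : Legal G u u := Or.inl rfl

theorem castSucc_add_one_val (m : Fin c) : (m.castSucc + 1 : Fin (c + 1)).val = m.val + 1 := by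
  simp

theorem State.step_turn (s : State V c) (v : V) : (s.step v).turn = s.turn + 1 := rfl

theorem State.step_pos_turn (s : State V c) (v : V) : (s.step v).pos s.turn = v := by
  simp [State.step]

theorem State.step_pos_of_ne (s : State V c) (v : V) {k : Fin (c + 1)} (h : k ≠ s.turn) :
    (s.step v).pos k = s.pos k := by
  simp [State.step, h]

theorem State.step_stay (s : State V c) : s.step (s.pos s.turn) = ⟨s.pos, s.turn + 1⟩ := by
  simp [State.step]

theorem State.step_robber_of_ne (s : State V c) (v : V) (h : s.turn ≠ Fin.last c) :
    (s.step v).robber = s.robber := s.step_pos_of_ne v h.symm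

theorem State.step_robber (s : State V c) (v : V) (h : s.turn = Fin.last c) :
    (s.step v).robber = v := by
  unfold State.robber; rw [← h]; exact s.step_pos_turn v

/-- If the move of cop `m` is a capture, then `m` is the only cop that captures. -/
theorem State.step_capturing_iff {s : State V c} (hs : ¬ s.IsCapture) {m : Fin c}
    (hm : s.turn = m.castSucc) {v : V} (hv : (s.step v).IsCapture) (i : Fin c) :
    (s.step v).pos i.castSucc = (s.step v).robber ↔ i = m := by
  have hl : s.turn ≠ Fin.last c := by rw [hm]; exact (Fin.castSucc_lt_last m).ne
  have key : ∀ j : Fin c, (s.step v).pos j.castSucc = (s.step v).robber → j = m := by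
    intro j hj
    by_contra hjm
    have : j.castSucc ≠ s.turn := by
      rw [hm]; intro h; exact hjm (Fin.castSucc_injective _ h)
    rw [s.step_pos_of_ne v this, s.step_robber_of_ne v hl] at hj
    exact hs ⟨j, hj⟩
  constructor
  · exact key i
  · rintro rfl
    obtain ⟨j, hj⟩ := hv
    have := key j hj
    subst this
    exact hj

theorem State.not_isCapture_stay {s : State V c} (hs : ¬ s.IsCapture) :
    ¬ (s.step (s.pos s.turn)).IsCapture := by
  rw [State.step_stay]; exact hs

/-! ### Reachability games -/

/-- The tokens in `A` can force a visit to `F` within `n` turns, whatever the other tokens do. -/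
def Attracts (G : SimpleGraph V) (A : Set (Fin (c + 1))) (F : State V c → Prop) :
    ℕ → State V c → Prop
  | 0, s => F s
  | n + 1, s => F s ∨ (s.turn ∈ A ∧ ∃ v, Legal G (s.pos s.turn) v ∧ Attracts G A F n (s.step v)) ∨
      (s.turn ∉ A ∧ ∀ v, Legal G (s.pos s.turn) v → Attracts G A F n (s.step v))

/-- The tokens outside of `A` can avoid `F` forever. -/
def Evades (G : SimpleGraph V) (A : Set (Fin (c + 1))) (F : State V c → Prop) (s : State V c) :
    Prop := ∀ n, ¬ Attracts G A F n s

variable {A : Set (Fin (c + 1))} {F : State V c → Prop} {s : State V c} {n k : ℕ}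

theorem Attracts.of_target (h : F s) : Attracts G A F n s := by
  cases n with
  | zero => exact h
  | succ n => exact Or.inl h

theorem Attracts.succ (h : Attracts G A F n s) : Attracts G A F (n + 1) s := by
  induction n generalizing s with
  | zero => exact Or.inl h
  | succ n ih =>
    rcases h with h | ⟨hA, v, hv, h⟩ | ⟨hA, h⟩
    · exact Or.inl h
    · exact Or.inr (Or.inl ⟨hA, v, hv, ih h⟩)
    · exact Or.inr (Or.inr ⟨hA, fun v hv => ih (h v hv)⟩)

theorem Attracts.mono (h : Attracts G A F n s) (hk : n ≤ k) : Attracts G A F k s := by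
  induction hk with
  | refl => exact h
  | step _ ih => exact ih.succ

theorem attracts_succ_of_mem (hA : s.turn ∈ A) {v : V} (hv : Legal G (s.pos s.turn) v)
    (h : Attracts G A F n (s.step v)) : Attracts G A F (n + 1) s :=
  Or.inr (Or.inl ⟨hA, v, hv, h⟩)

theorem attracts_succ_of_notMem (hA : s.turn ∉ A)
    (h : ∀ v, Legal G (s.pos s.turn) v → Attracts G A F n (s.step v)) :
    Attracts G A F (n + 1) s :=
  Or.inr (Or.inr ⟨hA, h⟩)

theorem Attracts.exists_of_mem (h : Attracts G A F (n + 1) s) (hF : ¬ F s) (hA : s.turn ∈ A) :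
    ∃ v, Legal G (s.pos s.turn) v ∧ Attracts G A F n (s.step v) := by
  rcases h with h | ⟨_, h⟩ | ⟨h, _⟩
  · exact absurd h hF
  · exact h
  · exact absurd hA h

theorem Attracts.forall_of_notMem (h : Attracts G A F (n + 1) s) (hF : ¬ F s) (hA : s.turn ∉ A)
    {v : V} (hv : Legal G (s.pos s.turn) v) : Attracts G A F n (s.step v) := by
  rcases h with h | ⟨h, _⟩ | ⟨_, h⟩
  · exact absurd h hF
  · exact absurd h hA
  · exact h v hv

theorem exists_attracts_of_not_evades (h : ¬ Evades G A F s) : ∃ n, Attracts G A F n s := by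
  simpa [Evades] using h

theorem Evades.not_target (h : Evades G A F s) : ¬ F s := h 0

theorem Evades.step_of_mem (h : Evades G A F s) (hA : s.turn ∈ A) {v : V}
    (hv : Legal G (s.pos s.turn) v) : Evades G A F (s.step v) :=
  fun n hn => h (n + 1) (attracts_succ_of_mem hA hv hn)

/-- If every move led to a forced visit, the finitely many time bounds would have a maximum. Without
finiteness the bounds need not be uniform. -/
theorem Evades.exists_of_notMem [Finite V] (h : Evades G A F s) (hA : s.turn ∉ A) :
    ∃ v, Legal G (s.pos s.turn) v ∧ Evades G A F (s.step v) := by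
  by_contra! hc
  have : ∀ v, ∃ n, Legal G (s.pos s.turn) v → Attracts G A F n (s.step v) := by
    intro v
    by_cases hv : Legal G (s.pos s.turn) v
    · obtain ⟨n, hn⟩ := exists_attracts_of_not_evades (hc v hv)
      exact ⟨n, fun _ => hn⟩
    · exact ⟨0, fun h => absurd h hv⟩
  choose N hN using this
  obtain ⟨M, hM⟩ := (Set.finite_range N).bddAbove
  exact h (M + 1) (attracts_succ_of_notMem hA fun v hv => (hN v hv).mono (hM ⟨v, rfl⟩))

/-! ### Positional play -/

/-- The next state under a profile of positional strategies. -/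
def PosProfile.next (σ : PosProfile G c) (s : State V c) : State V c :=
  s.step ((σ s.turn).move s)

theorem stateAt_succ (σ : Profile G c) (s : State V c) (t : ℕ) : stateAt σ s (t + 1) =
    (stateAt σ s t).step ((σ (stateAt σ s t).turn).move (run σ s t).1 (stateAt σ s t)) := rfl

theorem stateAt_toProfile (σ : PosProfile G c) (s : State V c) (t : ℕ) :
    stateAt σ.toProfile s t = σ.next^[t] s := by
  induction t with
  | zero => rfl
  | succ t ih => rw [Function.iterate_succ_apply', ← ih]; rfl

theorem stateAt_toProfile_succ (σ : PosProfile G c) (s : State V c) (t : ℕ) :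
    stateAt σ.toProfile s (t + 1) = stateAt σ.toProfile (σ.next s) t := by
  simp [stateAt_toProfile]

theorem leadsToCaptureBy_of_next {σ : PosProfile G c} {s : State V c} {m : Fin c}
    (hs : ¬ s.IsCapture) (h : LeadsToCaptureBy σ.toProfile (σ.next s) m) :
    LeadsToCaptureBy σ.toProfile s m := by
  obtain ⟨t, ⟨h1, h2⟩, h3⟩ := h
  refine ⟨t + 1, ⟨by rwa [stateAt_toProfile_succ], ?_⟩, by rwa [stateAt_toProfile_succ]⟩
  intro t' ht'
  cases t' with
  | zero => exact hs
  | succ t' => rw [stateAt_toProfile_succ]; exact h2 t' (by omega)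

theorem leadsToCaptureBy_of_pos {σ : Profile G c} {s : State V c} {m : Fin c}
    (h : s.pos m.castSucc = s.robber) : LeadsToCaptureBy σ s m :=
  ⟨0, ⟨⟨m, h⟩, fun _ ht => absurd ht (Nat.not_lt_zero _)⟩, h⟩

/-! ### Payoffs and values of the zero-sum games -/

section Payoff

variable {γ ε : ℝ} {m : Fin (c + 1)}

theorem payoff_of_isCapture (σ : Profile G c) (hs : s.IsCapture) :
    payoff γ ε m s σ = reward ε m s := by
  classical
  have h : ∃ t, (stateAt σ s t).IsCapture := ⟨0, hs⟩
  have h0 : Nat.find h = 0 := by rw [Nat.find_eq_zero]; exact hs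
  unfold payoff
  rw [dif_pos h]
  convert_to reward ε m (stateAt σ s (Nat.find h)) * γ ^ Nat.find h = _
  rw [h0, pow_zero, mul_one]; rfl

theorem payoff_of_not_isCapture (σ : PosProfile G c) (hs : ¬ s.IsCapture) :
    payoff γ ε m s σ.toProfile = γ * payoff γ ε m (σ.next s) σ.toProfile := by
  classical
  by_cases h : ∃ t, (stateAt σ.toProfile (σ.next s) t).IsCapture
  · have h' : ∃ t, (stateAt σ.toProfile s (t + 1)).IsCapture := by
      simpa only [stateAt_toProfile_succ] using h
    have h1 : ∃ t, (stateAt σ.toProfile s t).IsCapture := by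
      obtain ⟨t, ht⟩ := h'; exact ⟨_, ht⟩
    have e1 : Nat.find h1 = Nat.find h' + 1 := Nat.find_comp_succ h1 h' hs
    have e2 : Nat.find h' = Nat.find h := by
      congr 1; ext t; rw [stateAt_toProfile_succ]
    unfold payoff
    rw [dif_pos h1, dif_pos h]
    convert_to reward ε m (stateAt σ.toProfile s (Nat.find h1)) * γ ^ Nat.find h1 =
      γ * (reward ε m (stateAt σ.toProfile (σ.next s) (Nat.find h)) * γ ^ Nat.find h)
    rw [e1, e2, stateAt_toProfile_succ, pow_succ]
    ring
  · have h1 : ¬ ∃ t, (stateAt σ.toProfile s t).IsCapture := by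
      rintro ⟨t, ht⟩
      cases t with
      | zero => exact hs ht
      | succ t => exact h ⟨t, by rwa [stateAt_toProfile_succ] at ht⟩
    unfold payoff
    rw [dif_neg h1, dif_neg h, mul_zero]

theorem inv_natCast_le_one (k : ℕ) : 1 / (k : ℝ) ≤ 1 := by
  rcases Nat.eq_zero_or_pos k with rfl | h
  · simp
  · rw [div_le_one (by exact_mod_cast h)]; exact_mod_cast h

theorem reward_last : reward ε (Fin.last c) s = -1 := by simp [reward]

theorem reward_nonneg (m : Fin c) : 0 ≤ reward 0 m.castSucc s := by
  unfold reward
  split_ifs <;> simp_all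

theorem abs_reward_le_one (m : Fin (c + 1)) : |reward 0 m s| ≤ 1 := by
  unfold reward
  split_ifs
  · simp
  · rw [abs_of_nonneg (by positivity)]; exact inv_natCast_le_one c
  · rw [sub_zero, abs_of_nonneg (by positivity)]; exact inv_natCast_le_one _
  · simp

theorem abs_payoff_le_one (hγ : γ ∈ Set.Ioo (0 : ℝ) 1) (m : Fin (c + 1)) (s : State V c)
    (σ : Profile G c) : |payoff γ 0 m s σ| ≤ 1 := by
  unfold payoff
  split_ifs with h
  · rw [abs_mul, abs_of_nonneg (pow_nonneg hγ.1.le _)]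
    exact mul_le_one₀ (abs_reward_le_one m) (pow_nonneg hγ.1.le _) (pow_le_one₀ hγ.1.le hγ.2.le)
  · simp

theorem payoff_nonneg (hγ : γ ∈ Set.Ioo (0 : ℝ) 1) (m : Fin c) (s : State V c)
    (σ : Profile G c) : 0 ≤ payoff γ 0 m.castSucc s σ := by
  unfold payoff
  split_ifs with h
  · exact mul_nonneg (reward_nonneg m) (pow_nonneg hγ.1.le _)
  · exact le_rfl

theorem abs_payoff_le (hγ : γ ∈ Set.Ioo (0 : ℝ) 1) (m : Fin (c + 1)) (σ : PosProfile G c)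
    (hs : ¬ s.IsCapture) : |payoff γ 0 m s σ.toProfile| ≤ γ := by
  rw [payoff_of_not_isCapture σ hs, abs_mul, abs_of_pos hγ.1]
  exact mul_le_of_le_one_right hγ.1.le (abs_payoff_le_one hγ _ _ _)

/-- The uniform bound on payoffs is needed because a real infimum over an unbounded family would
carry no information. -/
theorem value_le_of_forall_exists (hγ : γ ∈ Set.Ioo (0 : ℝ) 1) (m : Fin (c + 1)) (s : State V c)
    {x : ℝ} (h : ∀ α : PosStrategy G c m, ∃ ρ, posPayoff γ 0 m s α ρ ≤ x) [Nonempty (PosStrategy G c m)] :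
    value G γ 0 m s ≤ x := by
  refine ciSup_le fun α => ?_
  obtain ⟨ρ, hρ⟩ := h α
  refine (ciInf_le ⟨-1, ?_⟩ ρ).trans hρ
  rintro _ ⟨ρ', rfl⟩
  exact (abs_le.1 (abs_payoff_le_one hγ _ _ _)).1

/-- A pair of strategies that guarantee the same number to both players determines the value. -/
theorem value_eq (hγ : γ ∈ Set.Ioo (0 : ℝ) 1) (m : Fin (c + 1)) (s : State V c)
    (φ : PosProfile G c) {x : ℝ} (h1 : ∀ ρ, x ≤ posPayoff γ 0 m s (φ m) ρ)
    (h2 : ∀ α, posPayoff γ 0 m s α φ ≤ x) : value G γ 0 m s = x := by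
  have : Nonempty (PosStrategy G c m) := ⟨φ m⟩
  have : Nonempty (PosProfile G c) := ⟨φ⟩
  refine le_antisymm (value_le_of_forall_exists hγ m s fun α => ⟨φ, h2 α⟩) ?_
  refine le_trans (le_ciInf h1) (le_ciSup (f := fun α : PosStrategy G c m =>
    ⨅ ρ : PosProfile G c, posPayoff γ 0 m s α ρ) ⟨x, ?_⟩ (φ m))
  rintro _ ⟨α, rfl⟩
  refine (ciInf_le ⟨-1, ?_⟩ φ).trans (h2 α)
  rintro _ ⟨ρ', rfl⟩
  exact (abs_le.1 (abs_payoff_le_one hγ _ _ _)).1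

theorem isOptimalProfile_of_forall (hγ : γ ∈ Set.Ioo (0 : ℝ) 1) (m : Fin (c + 1))
    (φ : PosProfile G c) (h : ∀ s, ∃ x : ℝ, (∀ ρ, x ≤ posPayoff γ 0 m s (φ m) ρ) ∧
      ∀ α, posPayoff γ 0 m s α φ ≤ x) : IsOptimalProfile γ 0 m φ := by
  constructor
  · intro s ρ
    obtain ⟨x, h1, h2⟩ := h s
    rw [value_eq hγ m s φ h1 h2]; exact h1 ρ
  · intro s α
    obtain ⟨x, h1, h2⟩ := h s
    rw [value_eq hγ m s φ h1 h2]; exact h2 α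

end Payoff

end Scar

namespace Scar

variable {V : Type*} {G : SimpleGraph V} {c : ℕ}

/-! ### The modified cops and robber game -/

/-- The cops together can force capture within `n` turns. -/
abbrev CapturesWithin (G : SimpleGraph V) (n : ℕ) (s : State V c) : Prop :=
  Attracts G {k | k ≠ Fin.last c} State.IsCapture n s

/-- The robber can evade all the cops forever. -/
abbrev Escapes (G : SimpleGraph V) (s : State V c) : Prop :=
  Evades G {k | k ≠ Fin.last c} State.IsCapture s

/-- The cops can force capture within `n` turns, and not earlier. -/
def CaptureRank (G : SimpleGraph V) (n : ℕ) (s : State V c) : Prop :=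
  CapturesWithin G n s ∧ ∀ k < n, ¬ CapturesWithin G k s

/-- A move that is optimal for the capture time. -/
def GreedyMove (G : SimpleGraph V) (s : State V c) (v : V) : Prop :=
  (s.turn ≠ Fin.last c → ∀ n, CapturesWithin G (n + 1) s → CapturesWithin G n (s.step v)) ∧
  (s.turn = Fin.last c → ∀ n, ¬ CapturesWithin G (n + 1) s → ¬ CapturesWithin G n (s.step v))

/-- A positional strategy all of whose moves are optimal for the capture time. -/
def PosStrategy.IsGreedy {n : Fin (c + 1)} (σ : PosStrategy G c n) : Prop :=
  ∀ s, ¬ s.IsCapture → s.turn = n → GreedyMove G s (σ.move s)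

variable {s : State V c} {n : ℕ} {γ : ℝ}

theorem exists_captureRank (h : ¬ Escapes G s) : ∃ n, CaptureRank G n s := by
  classical
  have h' := exists_attracts_of_not_evades h
  exact ⟨Nat.find h', Nat.find_spec h', fun k hk => Nat.find_min h' hk⟩

theorem CaptureRank.le (h : CaptureRank G n s) {k : ℕ} (hk : CapturesWithin G k s) : n ≤ k := by
  by_contra! hlt
  exact h.2 k hlt hk

theorem CaptureRank.not_escapes (h : CaptureRank G n s) : ¬ Escapes G s := fun he => he n h.1

theorem CaptureRank.eq_zero_iff (h : CaptureRank G n s) : n = 0 ↔ s.IsCapture := by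
  constructor
  · rintro rfl; exact h.1
  · intro hs; exact Nat.le_zero.1 (h.le (k := 0) hs)

theorem CaptureRank.exists_eq_succ (h : CaptureRank G n s) (hs : ¬ s.IsCapture) :
    ∃ k, n = k + 1 := Nat.exists_eq_succ_of_ne_zero (mt h.eq_zero_iff.1 hs)

theorem exists_greedyMove [Finite V] (hs : ¬ s.IsCapture) :
    ∃ v, Legal G (s.pos s.turn) v ∧ GreedyMove G s v := by
  by_cases he : Escapes G s
  · by_cases ht : s.turn = Fin.last c
    · obtain ⟨v, hv, h⟩ := Evades.exists_of_notMem he (by simp [ht])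
      exact ⟨v, hv, fun h' => absurd ht h', fun _ n _ => h n⟩
    · exact ⟨_, Legal.refl _, fun _ n hn => absurd hn (he _), fun h' => absurd h' ht⟩
  · obtain ⟨n, hn⟩ := exists_captureRank he
    obtain ⟨k, rfl⟩ := hn.exists_eq_succ hs
    by_cases ht : s.turn = Fin.last c
    -- At rank one every robber move is greedy, since the premise of the condition on him is false.
    · rcases Nat.eq_zero_or_pos k with rfl | hk
      · refine ⟨_, Legal.refl _, fun h' => absurd ht h', fun _ n hn' => ?_⟩
        exact absurd (hn.1.mono (Nat.succ_le_succ (Nat.zero_le n))) hn'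
      · obtain ⟨j, rfl⟩ := Nat.exists_eq_succ_of_ne_zero hk.ne'
        have h1 := hn.2 (j + 1) (Nat.lt_succ_self _)
        have : ∃ v, Legal G (s.pos s.turn) v ∧ ¬ CapturesWithin G j (s.step v) := by
          by_contra! hc
          exact h1 (attracts_succ_of_notMem (by simp [ht]) hc)
        obtain ⟨v, hv, h2⟩ := this
        refine ⟨v, hv, fun h' => absurd ht h', fun _ n hn' h3 => ?_⟩
        by_cases hnj : n ≤ j
        · exact h2 (h3.mono hnj)
        · exact hn' (hn.1.mono (by omega))
    · obtain ⟨v, hv, h⟩ := hn.1.exists_of_mem hs ht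
      refine ⟨v, hv, fun _ n hn' => h.mono ?_, fun h' => absurd h' ht⟩
      have := hn.le hn'
      omega

theorem exists_greedy_profile [Finite V] (G : SimpleGraph V) (c : ℕ) :
    ∃ g : PosProfile G c, ∀ n, (g n).IsGreedy := by
  classical
  have : ∀ s : State V c, ∃ v, Legal G (s.pos s.turn) v ∧ (¬ s.IsCapture → GreedyMove G s v) := by
    intro s
    by_cases hs : s.IsCapture
    · exact ⟨_, Legal.refl _, fun h => absurd hs h⟩
    · obtain ⟨v, hv, h⟩ := exists_greedyMove (G := G) hs
      exact ⟨v, hv, fun _ => h⟩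
  choose f hf hg using this
  refine ⟨fun n => ⟨f, ?_⟩, fun n s hs _ => hg s hs⟩
  rintro s rfl
  exact hf s

/-- Greedy moves of either side lower the rank by exactly one, so the length of greedy play is known
in advance. -/
theorem CaptureRank.step (h : CaptureRank G (n + 1) s) {v : V} (hs : ¬ s.IsCapture)
    (hv : Legal G (s.pos s.turn) v) (hg : GreedyMove G s v) : CaptureRank G n (s.step v) := by
  by_cases ht : s.turn = Fin.last c
  · exact ⟨h.1.forall_of_notMem hs (by simp [ht]) hv, fun k hk => hg.2 ht k (h.2 _ (by omega))⟩
  · exact ⟨hg.1 ht _ h.1, fun k hk hc =>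
      h.2 (k + 1) (by omega) (attracts_succ_of_mem (A := {k | k ≠ Fin.last c}) ht hv hc)⟩

theorem payoff_last_le (hγ : γ ∈ Set.Ioo (0 : ℝ) 1) {σ : PosProfile G c}
    (hσ : ∀ k ≠ Fin.last c, (σ k).IsGreedy) (h : CapturesWithin G n s) :
    payoff γ 0 (Fin.last c) s σ.toProfile ≤ - γ ^ n := by
  induction n generalizing s with
  | zero => rw [payoff_of_isCapture _ h, reward_last]; simp
  | succ n ih =>
    by_cases hs : s.IsCapture
    · rw [payoff_of_isCapture _ hs, reward_last]
      have := pow_le_one₀ hγ.1.le hγ.2.le (n := n + 1)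
      linarith
    · rw [payoff_of_not_isCapture _ hs]
      have : CapturesWithin G n (σ.next s) := by
        by_cases ht : s.turn = Fin.last c
        · exact h.forall_of_notMem hs (by simp [ht]) ((σ _).legal s rfl)
        · exact (hσ _ ht s hs rfl).1 ht n h
      have := mul_le_mul_of_nonneg_left (ih this) hγ.1.le
      rw [pow_succ]; linarith

/-- A greedy robber survives at least n + 1 turns, and rewards have absolute value at most 1. This
bounds the payoffs in the games of all players, not only in his own. -/
theorem abs_payoff_le_of_greedy_robber (hγ : γ ∈ Set.Ioo (0 : ℝ) 1) {σ : PosProfile G c}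
    (hσ : (σ (Fin.last c)).IsGreedy) (m : Fin (c + 1)) (h : ¬ CapturesWithin G n s) :
    |payoff γ 0 m s σ.toProfile| ≤ γ ^ (n + 1) := by
  induction n generalizing s with
  | zero => simpa using abs_payoff_le hγ m σ h
  | succ n ih =>
    have hs : ¬ s.IsCapture := fun hs => h (Attracts.of_target hs)
    rw [payoff_of_not_isCapture _ hs, abs_mul, abs_of_pos hγ.1, pow_succ']
    refine mul_le_mul_of_nonneg_left (ih ?_) hγ.1.le
    by_cases ht : s.turn = Fin.last c
    · have := (hσ s hs ht).2 ht n h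
      unfold PosProfile.next
      rwa [ht]
    · exact fun hc => h (attracts_succ_of_mem (A := {k | k ≠ Fin.last c}) ht ((σ _).legal s rfl) hc)

theorem payoff_eq_zero_of_escapes (hγ : γ ∈ Set.Ioo (0 : ℝ) 1) {σ : PosProfile G c}
    (hσ : (σ (Fin.last c)).IsGreedy) (m : Fin (c + 1)) (h : Escapes G s) :
    payoff γ 0 m s σ.toProfile = 0 := by
  by_contra hne
  obtain ⟨n, hn⟩ := exists_pow_lt_of_lt_one (abs_pos.2 hne) hγ.2
  have h1 := abs_payoff_le_of_greedy_robber hγ hσ m (h n)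
  have h2 := pow_le_pow_of_le_one hγ.1.le hγ.2.le (Nat.le_succ n)
  exact absurd (h1.trans h2) (not_le.2 hn)

theorem isOptimalProfile_last_of_greedy (hγ : γ ∈ Set.Ioo (0 : ℝ) 1) {g : PosProfile G c}
    (hg : ∀ n, (g n).IsGreedy) : IsOptimalProfile γ 0 (Fin.last c) g := by
  refine isOptimalProfile_of_forall hγ _ _ fun s => ?_
  have hr : ∀ ρ : PosProfile G c,
      ((Function.update ρ (Fin.last c) (g (Fin.last c)) : PosProfile G c) (Fin.last c)).IsGreedy := by
    intro ρ; rw [Function.update_self]; exact hg _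
  have hcop : ∀ α : PosStrategy G c (Fin.last c), ∀ k ≠ Fin.last c,
      ((Function.update g (Fin.last c) α : PosProfile G c) k).IsGreedy := by
    intro α k hk; rw [Function.update_of_ne hk]; exact hg _
  by_cases he : Escapes G s
  · refine ⟨0, fun ρ => (payoff_eq_zero_of_escapes hγ (hr ρ) _ he).ge, fun α => ?_⟩
    unfold posPayoff payoff
    split_ifs with h
    · rw [reward_last, neg_one_mul]
      exact neg_nonpos.2 (pow_nonneg hγ.1.le _)
    · exact le_rfl
  · obtain ⟨n, hn⟩ := exists_captureRank he
    refine ⟨-γ ^ n, fun ρ => ?_, fun α => payoff_last_le hγ (hcop α) hn.1⟩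
    cases n with
    | zero => rw [pow_zero]; exact (abs_le.1 (abs_payoff_le_one hγ _ _ _)).1
    | succ n => exact (abs_le.1 (abs_payoff_le_of_greedy_robber hγ (hr ρ) _
        (hn.2 n (Nat.lt_succ_self n)))).1

/-- A move that is not greedy costs its side at least one turn against greedy opponents. The payoff
then differs from the value, because distinct powers of γ are distinct. -/
theorem IsCROptimal.isGreedy [Finite V] (hγ : γ ∈ Set.Ioo (0 : ℝ) 1) {n : Fin (c + 1)}
    {σ : PosStrategy G c n} (h : IsCROptimal γ 0 σ) : σ.IsGreedy := by
  obtain ⟨φ, ⟨h1, h2⟩, rfl⟩ := h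
  obtain ⟨g, hg⟩ := exists_greedy_profile G c
  have hr : ((Function.update φ (Fin.last c) (g (Fin.last c)) : PosProfile G c)
      (Fin.last c)).IsGreedy := by
    rw [Function.update_self]; exact hg _
  have hcop : ∀ α : PosStrategy G c (Fin.last c), ∀ k ≠ Fin.last c,
      ((Function.update g (Fin.last c) α : PosProfile G c) k).IsGreedy := by
    intro α k hk; rw [Function.update_of_ne hk]; exact hg _
  rintro s hs rfl
  constructor
  · intro ht k hk
    by_contra hc
    have e1 := h2 s (g (Fin.last c))
    have e2 := (h1 s g).trans (show posPayoff γ 0 (Fin.last c) s (φ (Fin.last c)) g ≤ _ from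
      payoff_last_le hγ (hcop _) hk)
    unfold posPayoff at e1
    rw [payoff_of_not_isCapture _ hs] at e1
    have hnext : PosProfile.next (Function.update φ (Fin.last c) (g (Fin.last c))) s =
        s.step ((φ s.turn).move s) := by
      unfold PosProfile.next; rw [Function.update_of_ne ht]
    have e3 := (abs_le.1 (abs_payoff_le_of_greedy_robber hγ hr (Fin.last c) (hnext ▸ hc))).1
    have e4 := mul_le_mul_of_nonneg_left e3 hγ.1.le
    have e5 : γ * γ ^ (k + 1) < γ ^ (k + 1) :=
      mul_lt_of_lt_one_left (pow_pos hγ.1 _) hγ.2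
    linarith
  · intro ht k hk hc
    have e1 := h1 s g
    have e2 : -γ ^ (k + 1 + 1) ≤ posPayoff γ 0 (Fin.last c) s (g (Fin.last c)) φ :=
      (abs_le.1 (abs_payoff_le_of_greedy_robber hγ hr (Fin.last c) hk)).1
    have e3 := h2 s (g (Fin.last c))
    unfold posPayoff at e1
    rw [payoff_of_not_isCapture _ hs] at e1
    have hnext : PosProfile.next (Function.update g (Fin.last c) (φ (Fin.last c))) s =
        s.step ((φ s.turn).move s) := by
      unfold PosProfile.next; rw [ht, Function.update_self]
    have e4 := mul_le_mul_of_nonneg_left (payoff_last_le hγ (hcop (φ (Fin.last c)))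
      (hnext ▸ hc)) hγ.1.le
    have e5 : γ ^ (k + 1 + 1) < γ ^ (k + 1) :=
      pow_lt_pow_right_of_lt_one₀ hγ.1 hγ.2 (Nat.lt_succ_self _)
    rw [pow_succ γ k] at e5
    linarith [e4, mul_comm γ (γ ^ k)]

/-! ### The capturing cop -/

/-- Optimal play from `s` lasts `n ≥ 1` turns, and the last of them belongs to cop `m`. -/
structure IsFinisher (G : SimpleGraph V) (n : ℕ) (m : Fin c) (s : State V c) : Prop where
  rank : CaptureRank G n s
  not_isCapture : ¬ s.IsCapture
  turn : (fun i : Fin (c + 1) => i + 1)^[n] s.turn = m.castSucc + 1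

theorem not_captureRank_one_of_robber (hs : ¬ s.IsCapture) (ht : s.turn = Fin.last c) :
    ¬ CapturesWithin G 1 s := fun h =>
  State.not_isCapture_stay hs (h.forall_of_notMem hs (by simp [ht]) (Legal.refl _))

/-- The last turn cannot be the robber's, because at a noncapture state he can stay put. -/
theorem CaptureRank.exists_isFinisher [Finite V] (h : CaptureRank G n s) (hs : ¬ s.IsCapture) :
    ∃ m, IsFinisher G n m s := by
  induction n generalizing s with
  | zero => exact absurd h.1 hs
  | succ n ih =>
    cases n with
    | zero =>
      have ht : s.turn ≠ Fin.last c := fun ht => not_captureRank_one_of_robber hs ht h.1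
      obtain ⟨m, hm⟩ := Fin.exists_castSucc_eq.2 ht
      exact ⟨m, h, hs, by simp [hm]⟩
    | succ n =>
      obtain ⟨v, hv, hg⟩ := exists_greedyMove (G := G) hs
      have h' := h.step hs hv hg
      obtain ⟨m, hm⟩ := ih h' (mt h'.eq_zero_iff.2 (Nat.succ_ne_zero n))
      exact ⟨m, h, hs, hm.turn⟩

theorem exists_isFinisher [Finite V] (h : ¬ Escapes G s) (hs : ¬ s.IsCapture) :
    ∃ n m, IsFinisher G n m s := by
  obtain ⟨n, hn⟩ := exists_captureRank h
  obtain ⟨m, hm⟩ := hn.exists_isFinisher hs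
  exact ⟨n, m, hm⟩

theorem IsFinisher.turn_eq {m : Fin c} (h : IsFinisher G 1 m s) : s.turn = m.castSucc :=
  add_right_cancel h.turn

theorem IsFinisher.pos {m : Fin c} (h : IsFinisher G n m s) : ∃ k, n = k + 1 :=
  h.rank.exists_eq_succ h.not_isCapture

theorem IsFinisher.step {m : Fin c} (h : IsFinisher G (n + 1 + 1) m s) {v : V}
    (hv : CaptureRank G (n + 1) (s.step v)) : IsFinisher G (n + 1) m (s.step v) :=
  ⟨hv, mt hv.eq_zero_iff.2 (Nat.succ_ne_zero n), h.turn⟩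

theorem IsFinisher.leadsToCaptureBy {m : Fin c} (h : IsFinisher G n m s) {σ : PosProfile G c}
    (hσ : ∀ n, (σ n).IsGreedy) : LeadsToCaptureBy σ.toProfile s m := by
  induction n generalizing s with
  | zero => obtain ⟨k, hk⟩ := h.pos; omega
  | succ n ih =>
    have h' : CaptureRank G n (σ.next s) :=
      h.rank.step h.not_isCapture ((σ _).legal s rfl) (hσ _ s h.not_isCapture rfl)
    refine leadsToCaptureBy_of_next h.not_isCapture ?_
    cases n with
    | zero =>
      exact leadsToCaptureBy_of_pos
        ((State.step_capturing_iff h.not_isCapture h.turn_eq h'.1 m).2 rfl)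
    | succ n => exact ih (h.step h')

theorem IsFinisher.isCapturer [Finite V] (hγ : γ ∈ Set.Ioo (0 : ℝ) 1) {m : Fin c}
    (h : IsFinisher G n m s) : IsCapturer G γ 0 s m :=
  fun _ hσ => h.leadsToCaptureBy fun k => (hσ k).isGreedy hγ

/-! ### The state cop number -/

theorem stateCopNumber_ne_top [Finite V] (hc : 0 < c) (h : ¬ Escapes G s) :
    stateCopNumber G s ≠ ⊤ := by
  have : NeZero c := ⟨hc.ne'⟩
  obtain ⟨g, hg⟩ := exists_greedy_profile G c
  obtain ⟨n, hn⟩ := exists_attracts_of_not_evades h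
  have key : IsGuaranteedCapture s Finset.univ fun i => (g i.castSucc).toStrategy := by
    intro ρ hρ
    by_contra hno
    have hno' : ∀ t, ¬ (stateAt ρ s t).IsCapture := fun t ht => hno ⟨t, ht⟩
    have : ∀ t k, t + k = n → CapturesWithin G k (stateAt ρ s t) := by
      intro t
      induction t with
      | zero => rintro k hk; obtain rfl : k = n := by omega
                exact hn
      | succ t ih =>
        intro k hk
        have h1 := ih (k + 1) (by omega)
        rw [stateAt_succ]
        by_cases ht : (stateAt ρ s t).turn = Fin.last c
        · exact h1.forall_of_notMem (hno' t) (by simp [ht]) ((ρ _).legal _ _ rfl)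
        · obtain ⟨i, hi⟩ := Fin.exists_castSucc_eq.2 ht
          rw [← hi, hρ i (Finset.mem_univ i)]
          exact (hg _ _ (hno' t) hi.symm).1 ht k h1
    exact hno' n (this n 0 (by omega))
  refine ne_top_of_le_ne_top (ENat.natCast_ne_top (Finset.univ : Finset (Fin c)).card)
    (sInf_le ⟨Finset.univ, Finset.univ_nonempty, rfl, _, key⟩)

theorem stateCopNumber_eq_top [Finite V] (h : Escapes G s) : stateCopNumber G s = ⊤ := by
  classical
  rw [stateCopNumber, sInf_eq_top]
  rintro k ⟨I, -, -, σ, hσ⟩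
  exfalso
  obtain ⟨g, hg⟩ := exists_greedy_profile G c
  let ρ : Profile G c := Fin.lastCases (g (Fin.last c)).toStrategy σ
  have hl : ρ (Fin.last c) = (g (Fin.last c)).toStrategy := by simp [ρ]
  obtain ⟨t, ht⟩ := hσ ρ fun i _ => by simp [ρ]
  have : ∀ t, Escapes G (stateAt ρ s t) := by
    intro t
    induction t with
    | zero => exact h
    | succ t ih =>
      rw [stateAt_succ]
      by_cases ht : (stateAt ρ s t).turn = Fin.last c
      · rw [ht, hl]
        exact fun n => (hg _ _ ih.not_target ht).2 ht n (ih _)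
      · exact ih.step_of_mem ht ((ρ _).legal _ _ rfl)
  exact (this t).not_target ht

theorem stateCopNumber_eq_one [Finite V] (hG : ClassG1' G c) (hs : ¬ s.IsCapture)
    (h : stateCopNumber G s ≠ ⊤) : stateCopNumber G s = 1 := by
  have hne : {k : ℕ∞ | ∃ I : Finset (Fin c), I.Nonempty ∧ k = (I.card : ℕ∞) ∧
    ∃ σ : ∀ i : Fin c, Strategy G c i.castSucc, IsGuaranteedCapture s I σ}.Nonempty := by
    by_contra hemp
    rw [Set.not_nonempty_iff_eq_empty] at hemp
    exact h (by rw [stateCopNumber, hemp, sInf_empty])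
  obtain ⟨I, hI, hk, -⟩ := csInf_mem hne
  have h1 : 1 ≤ I.card := hI.card_pos
  have h2 : I.card ≤ c := by simpa using I.card_le_univ
  rcases h1.eq_or_lt with h1 | h1
  · rw [stateCopNumber, hk, ← h1]; rfl
  · exact absurd ⟨hG.1, s, hs, I.card, h1, h2, hk⟩ hG.2

end Scar

namespace Scar

variable {V : Type*} {G : SimpleGraph V} {c : ℕ}

/-! ### Capture by a single cop -/

/-- Cop `m` alone can force to be on the vertex of the robber within `n` turns. -/
abbrev CatchesWithin (G : SimpleGraph V) (m : Fin c) (n : ℕ) (s : State V c) : Prop :=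
  Attracts G {m.castSucc} (fun s => s.pos m.castSucc = s.robber) n s

/-- Cop `m` has a positional strategy with which he takes part in the capture from `s`. -/
def Guarantees (G : SimpleGraph V) (m : Fin c) (s : State V c) : Prop :=
  ∃ τ : PosStrategy G c m.castSucc, ∀ ρ : Profile G c, ρ m.castSucc = τ.toStrategy →
    LeadsToCaptureBy ρ s m

variable {s s' : State V c} {n : ℕ} {γ : ℝ} {m : Fin c}

/-- The other cops may simply stay where they are. -/
theorem CatchesWithin.capturesWithin (h : CatchesWithin G m n s) : CapturesWithin G n s := by
  induction n generalizing s with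
  | zero => exact ⟨m, h⟩
  | succ n ih =>
    rcases h with h | ⟨ht, v, hv, h⟩ | ⟨ht, h⟩
    · exact Attracts.of_target ⟨m, h⟩
    · refine attracts_succ_of_mem ?_ hv (ih h)
      rw [Set.mem_singleton_iff.1 ht]
      exact (Fin.castSucc_lt_last m).ne
    · by_cases hl : s.turn = Fin.last c
      · exact attracts_succ_of_notMem (by simp [hl]) fun v hv => ih (h v hv)
      · exact attracts_succ_of_mem (A := {k | k ≠ Fin.last c}) hl (Legal.refl _)
          (ih (h _ (Legal.refl _)))

/-- Two states agree on everything that matters to cop `m` in the pursuit of the robber. -/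
structure AgreeFor (m : Fin c) (s s' : State V c) : Prop where
  turn : s.turn = s'.turn
  pos : s.pos m.castSucc = s'.pos m.castSucc
  robber : s.robber = s'.robber

theorem AgreeFor.step (h : AgreeFor m s s') (v : V) : AgreeFor m (s.step v) (s'.step v) := by
  have key : ∀ k, s.pos k = s'.pos k → (s.step v).pos k = (s'.step v).pos k := by
    intro k hk
    by_cases hkt : k = s.turn
    · rw [hkt, s.step_pos_turn, h.turn, s'.step_pos_turn]
    · rw [s.step_pos_of_ne v hkt, s'.step_pos_of_ne v (h.turn ▸ hkt), hk]
  exact ⟨by rw [s.step_turn, s'.step_turn, h.turn], key _ h.pos, key _ h.robber⟩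

theorem agreeFor_step_step (h : AgreeFor m s s') (hm : s.turn ≠ m.castSucc)
    (hl : s.turn ≠ Fin.last c) (v v' : V) : AgreeFor m (s.step v) (s'.step v') :=
  ⟨by rw [s.step_turn, s'.step_turn, h.turn],
    by rw [s.step_pos_of_ne v hm.symm, s'.step_pos_of_ne v' (h.turn ▸ hm.symm), h.pos],
    by rw [s.step_robber_of_ne v hl, s'.step_robber_of_ne v' (h.turn ▸ hl), h.robber]⟩

theorem CatchesWithin.congr (h : CatchesWithin G m n s) (hss : AgreeFor m s s') :
    CatchesWithin G m n s' := by
  induction n generalizing s s' with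
  | zero =>
    change s'.pos m.castSucc = s'.robber
    rw [← hss.pos, ← hss.robber]; exact h
  | succ n ih =>
    rcases h with h | ⟨ht, v, hv, h⟩ | ⟨ht, h⟩
    · refine Attracts.of_target ?_
      rw [← hss.pos, ← hss.robber]; exact h
    · refine attracts_succ_of_mem (hss.turn ▸ ht) (v := v) ?_ (ih h (hss.step v))
      rw [Set.mem_singleton_iff] at ht
      rw [← hss.turn, ht, ← hss.pos, ← ht]
      exact hv
    · refine attracts_succ_of_notMem (hss.turn ▸ ht) fun v hv => ?_
      by_cases hl : s.turn = Fin.last c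
      · refine ih (h v ?_) (hss.step v)
        have := hss.robber
        unfold State.robber at this
        rw [hl, this, ← hl, hss.turn]
        exact hv
      · exact ih (h _ (Legal.refl _)) (agreeFor_step_step hss ht hl _ v)

/-- The capture condition that distinguishes 𝒢₃ within 𝒢₂' is invoked here, and everything about the
geometry of the graph follows from this consequence. -/
theorem IsFinisher.guarantees [Finite V] (hc : 0 < c) (hγ : γ ∈ Set.Ioo (0 : ℝ) 1)
    (hG3 : ClassG3 G c γ 0) (h : IsFinisher G n m s) : Guarantees G m s := by
  obtain ⟨τ, -, hτ⟩ := hG3.2 s h.not_isCapture (stateCopNumber_eq_one hG3.1.1 h.not_isCapture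
    (stateCopNumber_ne_top hc h.rank.not_escapes)) m (h.isCapturer hγ)
  exact ⟨τ, hτ⟩

/-- Otherwise the other tokens could evade forever, and their evading moves form positional
strategies. -/
theorem Guarantees.exists_catchesWithin [Finite V] (h : Guarantees G m s) :
    ∃ n, CatchesWithin G m n s := by
  classical
  by_contra! hno
  obtain ⟨τ, hτ⟩ := h
  let E : State V c → Prop := Evades G {m.castSucc} (fun s => s.pos m.castSucc = s.robber)
  have : ∀ s : State V c, ∃ v, Legal G (s.pos s.turn) v ∧
      (s.turn ≠ m.castSucc → E s → E (s.step v)) := by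
    intro s
    by_cases hs : s.turn ≠ m.castSucc ∧ E s
    · obtain ⟨v, hv, h⟩ := hs.2.exists_of_notMem hs.1
      exact ⟨v, hv, fun _ _ => h⟩
    · exact ⟨_, Legal.refl _, fun h1 h2 => absurd ⟨h1, h2⟩ hs⟩
  choose f hf hE using this
  let ρ : PosProfile G c := Function.update (fun n => ⟨f, by rintro s rfl; exact hf s⟩) m.castSucc τ
  obtain ⟨t, -, ht⟩ := hτ ρ.toProfile (by simp [PosProfile.toProfile, ρ])
  have key : ∀ t, E (stateAt ρ.toProfile s t) := by
    intro t
    induction t with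
    | zero => exact hno
    | succ t ih =>
      rw [stateAt_succ]
      by_cases ht : (stateAt ρ.toProfile s t).turn = m.castSucc
      · exact ih.step_of_mem ht ((ρ.toProfile _).legal _ _ rfl)
      · convert hE _ ht ih using 2
        simp [PosProfile.toProfile, ρ, Function.update_of_ne ht, PosStrategy.toStrategy]
  exact (key t).not_target ht

/-- Where a cop guarantees to take part in the capture, the robber is not next to another cop who
stands elsewhere. -/
theorem Guarantees.pos_eq (h : Guarantees G m s) (hs : ¬ s.IsCapture) (ht : s.turn = Fin.last c)
    {y : V} (hy : Legal G s.robber y) {k : Fin c} (hk : s.pos k.castSucc = y) :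
    s.pos m.castSucc = y := by
  classical
  obtain ⟨τ, hτ⟩ := h
  have hml : m.castSucc ≠ Fin.last c := (Fin.castSucc_lt_last m).ne
  -- The robber walks onto cop `k` at once; a cop that takes part in every capture must then already
  -- be there.
  let α : PosStrategy G c (Fin.last c) := ⟨fun s' => if s' = s then y else s'.pos (Fin.last c), by
    intro s' _
    split_ifs with h
    · rw [h]; exact hy
    · exact Legal.refl _⟩
  let ρ : PosProfile G c := Function.update (Function.update
    (fun n => ⟨fun s => s.pos n, fun s _ => Legal.refl _⟩) (Fin.last c) α) m.castSucc τ
  obtain ⟨t, ⟨-, ht2⟩, ht3⟩ := hτ ρ.toProfile (by simp [PosProfile.toProfile, ρ])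
  have h1 : stateAt ρ.toProfile s 1 = s.step y := by
    rw [stateAt_toProfile, Function.iterate_one]
    unfold PosProfile.next
    rw [ht]
    simp [ρ, α, Function.update_of_ne hml.symm]
  have hcap : (stateAt ρ.toProfile s 1).IsCapture := by
    rw [h1]
    refine ⟨k, ?_⟩
    rw [s.step_robber y ht, s.step_pos_of_ne y (ht ▸ (Fin.castSucc_lt_last k).ne), hk]
  have htle : t ≤ 1 := by
    by_contra! hlt
    exact ht2 1 hlt hcap
  interval_cases t
  · exact absurd ⟨m, ht3⟩ hs
  · rw [h1, s.step_robber y ht, s.step_pos_of_ne y (ht ▸ hml)] at ht3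
    exact ht3

/-- The state in which cop `k` is at `p`, the other cops are at `y`, and the robber is at `x` and
has the move. -/
def robberState (k : Fin c) (p y x : V) : State V c :=
  ⟨Fin.snoc (α := fun _ => V) (Function.update (fun _ => y) k p) x, Fin.last c⟩

theorem robberState_robber (k : Fin c) (p y x : V) : (robberState k p y x).robber = x := by
  simp only [robberState, State.robber, Fin.snoc_last]

theorem robberState_pos (k : Fin c) (p y x : V) (i : Fin c) :
    (robberState k p y x).pos i.castSucc = Function.update (fun _ => y) k p i := by
  simp only [robberState, Fin.snoc_castSucc]

theorem robberState_not_isCapture (k : Fin c) {p y x : V} (hp : p ≠ x) (hy : y ≠ x) :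
    ¬ (robberState k p y x).IsCapture := by
  rintro ⟨i, hi⟩
  rw [robberState_robber, robberState_pos] at hi
  by_cases hik : i = k
  · subst hik; rw [Function.update_self] at hi; exact hp hi
  · rw [Function.update_of_ne hik] at hi; exact hy hi

/-- The pursuit by cop `m` depends only on his own position and the robber's, so the other cops can
be relocated at will. -/
theorem Guarantees.robberState_not_escapes [Finite V] (h : Guarantees G m s)
    (ht : s.turn = Fin.last c) (y : V) :
    ¬ Escapes G (robberState m (s.pos m.castSucc) y s.robber) := by
  intro he
  obtain ⟨n, hn⟩ := h.exists_catchesWithin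
  refine he n (hn.congr ⟨ht, ?_, ?_⟩).capturesWithin
  · rw [robberState_pos, Function.update_self]
  · rw [robberState_robber]

/-- The vertex `x` has the only neighbour `w`. -/
def IsLeafAt (G : SimpleGraph V) (x w : V) : Prop := ∀ v, G.Adj x v ↔ v = w

theorem IsLeafAt.adj {x w : V} (h : IsLeafAt G x w) : G.Adj x w := (h w).2 rfl

theorem IsLeafAt.legal {x w v : V} (h : IsLeafAt G x w) (hv : Legal G x v) : v = x ∨ v = w :=
  hv.imp_right (h v).1

theorem mem_of_connected (hG : G.Connected) {S : Set V} {x : V} (hx : x ∈ S)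
    (hS : ∀ a ∈ S, ∀ b, G.Adj a b → b ∈ S) (y : V) : y ∈ S := by
  obtain ⟨p⟩ := hG.preconnected x y
  induction p with
  | nil => exact hx
  | cons h _ ih => exact ih (hS _ hx _ h)

/-- Put all cops except `m` on `y`. Capture can still be forced, and as the robber may walk into
`y`, the new finisher must be at `y`. At least two cops are needed for `y` to be occupied. -/
theorem Guarantees.exists_beside [Finite V] (hc : 2 ≤ c) (hγ : γ ∈ Set.Ioo (0 : ℝ) 1)
    (hG3 : ClassG3 G c γ 0) (h : Guarantees G m s) (hs : ¬ s.IsCapture)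
    (ht : s.turn = Fin.last c) {y : V} (hy : G.Adj s.robber y) :
    ∃ (m' : Fin c) (s' : State V c), Guarantees G m' s' ∧ ¬ s'.IsCapture ∧
      s'.turn = Fin.last c ∧ s'.robber = s.robber ∧ s'.pos m'.castSucc = y ∧
      s'.pos m.castSucc = s.pos m.castSucc := by
  have hs' : ¬ (robberState m (s.pos m.castSucc) y s.robber).IsCapture :=
    robberState_not_isCapture m (fun h => hs ⟨m, h⟩) hy.ne'
  obtain ⟨n, m', hm'⟩ := exists_isFinisher (h.robberState_not_escapes ht y) hs'
  have hg := hm'.guarantees (by omega) hγ hG3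
  have : Nontrivial (Fin c) := Fin.nontrivial_iff_two_le.2 hc
  obtain ⟨k, hk⟩ := exists_ne m
  refine ⟨m', _, hg, hs', rfl, robberState_robber .., ?_, ?_⟩
  · refine hg.pos_eq hs' rfl (k := k) ?_ ?_
    · rw [robberState_robber]; exact Or.inr hy
    · rw [robberState_pos, Function.update_of_ne hk]
  · rw [robberState_pos, Function.update_self]

/-- With two neighbours v and w of the robber, relocate twice: first a finisher at v, then, keeping
that cop there, a finisher at w. The robber can now step to v, which the finisher at w does not
attend. -/
theorem Guarantees.exists_isLeafAt [Finite V] (hG : G.Connected) (hc : 2 ≤ c) (hγ : γ ∈ Set.Ioo (0 : ℝ) 1)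
    (hG3 : ClassG3 G c γ 0) (h : Guarantees G m s) (hs : ¬ s.IsCapture)
    (ht : s.turn = Fin.last c) : ∃ w, IsLeafAt G s.robber w := by
  have hw : ∃ w, G.Adj s.robber w := by
    by_contra! hno
    have := mem_of_connected hG (S := {s.robber}) rfl
      (by rintro a rfl b hb; exact absurd hb (hno b)) (s.pos m.castSucc)
    exact hs ⟨m, this⟩
  obtain ⟨w, hw⟩ := hw
  refine ⟨w, fun v => ⟨fun hv => ?_, fun h => h ▸ hw⟩⟩
  by_contra hvw
  obtain ⟨m₁, s₁, h₁, hs₁, ht₁, hr₁, hp₁, -⟩ := h.exists_beside hc hγ hG3 hs ht hv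
  obtain ⟨m₂, s₂, h₂, hs₂, ht₂, hr₂, hp₂, hq₂⟩ := h₁.exists_beside hc hγ hG3 hs₁ ht₁ (y := w)
    (hr₁ ▸ hw)
  have := h₂.pos_eq hs₂ ht₂ (y := v) (k := m₁) (by rw [hr₂, hr₁]; exact Or.inr hv)
    (by rw [hq₂, hp₁])
  exact hvw (this.symm.trans hp₂)

/-- If no cop who still has to move in this round is next to the robber, then the robber survives
the round. -/
theorem exists_robber_turn (d : ℕ) (s : State V c) (hd : s.turn.val + d = c)
    (he : ¬ Escapes G s) (hs : ¬ s.IsCapture)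
    (hfar : ∀ i : Fin c, s.turn.val ≤ i.val → ¬ Legal G (s.pos i.castSucc) s.robber) :
    ∃ s' : State V c, s'.turn = Fin.last c ∧ ¬ s'.IsCapture ∧ ¬ Escapes G s' ∧
      s'.robber = s.robber := by
  induction d generalizing s with
  | zero => exact ⟨s, Fin.ext (by simpa using hd), hs, he, rfl⟩
  | succ d ih =>
    have hl : s.turn ≠ Fin.last c := by intro h; rw [h, Fin.val_last] at hd; omega
    obtain ⟨n, hn⟩ := exists_captureRank he
    obtain ⟨k, rfl⟩ := hn.exists_eq_succ hs
    obtain ⟨v, hv, h⟩ := hn.1.exists_of_mem hs hl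
    obtain ⟨j, hj⟩ := Fin.exists_castSucc_eq.2 hl
    have hval : (s.turn + 1).val = s.turn.val + 1 := by rw [← hj, castSucc_add_one_val]; rfl
    obtain ⟨s', h1, h2, h3, h4⟩ := ih (s.step v) (by rw [s.step_turn, hval]; omega)
      (fun he' => he' k h) (fun hcap => by
        have := (State.step_capturing_iff hs hj.symm hcap j).2 rfl
        rw [hj, s.step_pos_turn, s.step_robber_of_ne v hl] at this
        refine hfar j (by rw [← hj]; rfl) ?_
        rw [hj, ← this]; exact hv) (fun i hi => by
        rw [s.step_turn, hval] at hi
        have hne : i.castSucc ≠ s.turn := by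
          intro h; rw [← h] at hi; simp at hi
        rw [s.step_pos_of_ne v hne, s.step_robber_of_ne v hl]
        exact hfar i (by omega))
    exact ⟨s', h1, h2, h3, by rw [h4, s.step_robber_of_ne v hl]⟩

/-- Put all cops on the vertex of `m`. If it is far from `w`, the robber moves to `w` and survives
the round, so `w` is a leaf as well. Then the graph is a single edge, which leaves no room for the
cop. -/
theorem Guarantees.legal_of_isLeafAt [Finite V] (hG : G.Connected) (hc : 2 ≤ c) (hγ : γ ∈ Set.Ioo (0 : ℝ) 1)
    (hG3 : ClassG3 G c γ 0) (h : Guarantees G m s) (hs : ¬ s.IsCapture)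
    (ht : s.turn = Fin.last c) {w : V} (hw : IsLeafAt G s.robber w) :
    Legal G (s.pos m.castSucc) w := by
  by_contra hno
  have hp : s.pos m.castSucc ≠ s.robber := fun h => hs ⟨m, h⟩
  set q := robberState m (s.pos m.castSucc) (s.pos m.castSucc) s.robber with hq
  have hqs : ¬ q.IsCapture := robberState_not_isCapture m hp hp
  have hqe : ¬ Escapes G q := h.robberState_not_escapes ht _
  have hqt : q.turn = Fin.last c := rfl
  have hqr : q.robber = s.robber := robberState_robber ..
  have hqp : ∀ i : Fin c, q.pos i.castSucc = s.pos m.castSucc := by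
    intro i; rw [hq, robberState_pos]; simp
  have hqw : (q.step w).robber = w := q.step_robber w hqt
  have hqp' : ∀ i : Fin c, (q.step w).pos i.castSucc = s.pos m.castSucc := by
    intro i; rw [q.step_pos_of_ne w (Fin.castSucc_lt_last i).ne, hqp]
  obtain ⟨n, hn⟩ := exists_captureRank hqe
  obtain ⟨k, rfl⟩ := hn.exists_eq_succ hqs
  have hk : CapturesWithin G k (q.step w) := by
    refine hn.1.forall_of_notMem hqs (by simp [hqt]) ?_
    change Legal G q.robber w
    rw [hqr]; exact Or.inr hw.adj
  obtain ⟨s', h1, h2, h3, h4⟩ := exists_robber_turn c (q.step w)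
    (by rw [q.step_turn, hqt]; simp) (fun he => he k hk)
    (by
      rintro ⟨i, hi⟩
      rw [hqp', hqw] at hi
      exact hno (Or.inl hi.symm))
    (by intro i _; rw [hqp', hqw]; exact hno)
  obtain ⟨n', m', hm'⟩ := exists_isFinisher h3 h2
  obtain ⟨w', hw'⟩ := (hm'.guarantees (by omega) hγ hG3).exists_isLeafAt hG hc hγ hG3 h2 h1
  rw [h4, hqw] at hw'
  have hx : s.robber = w' := (hw' _).1 hw.adj.symm
  subst hx
  rcases mem_of_connected hG (S := {s.robber, w}) (Or.inr rfl) (by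
    rintro a (rfl | rfl) b hb
    · exact Or.inr ((hw b).1 hb)
    · exact Or.inl ((hw' b).1 hb)) (s.pos m.castSucc) with h | h
  · exact hp h
  · exact hno (Or.inl h.symm)

theorem IsFinisher.exists_isLeafAt [Finite V] (hG : G.Connected) (hc : 2 ≤ c) (hγ : γ ∈ Set.Ioo (0 : ℝ) 1)
    (hG3 : ClassG3 G c γ 0) (h : IsFinisher G n m s) (ht : s.turn = Fin.last c) :
    ∃ w, IsLeafAt G s.robber w ∧ Legal G (s.pos m.castSucc) w := by
  have hg := h.guarantees (by omega) hγ hG3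
  obtain ⟨w, hw⟩ := hg.exists_isLeafAt hG hc hγ hG3 h.not_isCapture ht
  exact ⟨w, hw, hg.legal_of_isLeafAt hG hc hγ hG3 h.not_isCapture ht hw⟩

/-! ### How long a single cop needs -/

theorem iterate_add_one_val (n : ℕ) (t : Fin (c + 1)) :
    ((fun i : Fin (c + 1) => i + 1)^[n] t).val = (t.val + n) % (c + 1) := by
  induction n generalizing t with
  | zero => simp [Nat.mod_eq_of_lt t.isLt]
  | succ n ih =>
    rw [Function.iterate_succ_apply, ih, Fin.val_add, Nat.mod_add_mod, Fin.val_one', Nat.add_assoc,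
      Nat.add_comm _ n, ← Nat.add_assoc, Nat.add_mod_mod]
    congr 1

/-- At the turn of the robber, the number of turns up to the end of the move of cop `m` is
determined up to full rounds. -/
theorem IsFinisher.eq_or_le (h : IsFinisher G n m s) (ht : s.turn = Fin.last c) :
    n = m.val + 2 ∨ m.val + c + 3 ≤ n := by
  obtain ⟨k, rfl⟩ := h.pos
  have h1 := congrArg Fin.val h.turn
  rw [iterate_add_one_val, ht, castSucc_add_one_val, Fin.val_last,
    show c + (k + 1) = k + (c + 1) by omega, Nat.add_mod_right] at h1
  have h2 := Nat.div_add_mod k (c + 1)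
  rw [h1] at h2
  rcases Nat.eq_zero_or_pos (k / (c + 1)) with h3 | h3
  · rw [h3] at h2; omega
  · have := Nat.le_mul_of_pos_right (c + 1) h3
    omega

theorem IsFinisher.val_add_eq (h : IsFinisher G n m s) (hn : s.turn.val + n ≤ c) :
    s.turn.val + n = m.val + 1 := by
  have h1 := congrArg Fin.val h.turn
  rwa [iterate_add_one_val, castSucc_add_one_val, Nat.mod_eq_of_lt (by omega)] at h1

theorem val_add_one {i : Fin (c + 1)} (h : i ≠ Fin.last c) : (i + 1).val = i.val + 1 := by
  obtain ⟨j, rfl⟩ := Fin.exists_castSucc_eq.2 h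
  rw [castSucc_add_one_val]; rfl

theorem ne_last_of_val_lt {i : Fin (c + 1)} (h : i.val < c) : i ≠ Fin.last c := by
  rintro rfl; simp at h

/-- A cop next to the robber catches him in his next move, if that comes before the next move of
the robber. -/
theorem catchesWithin_of_legal (d : ℕ) (s : State V c) (hd : s.turn.val + d = m.val)
    (h : Legal G (s.pos m.castSucc) s.robber) : CatchesWithin G m (d + 1) s := by
  induction d generalizing s with
  | zero =>
    have ht : s.turn = m.castSucc := Fin.ext (by simpa using hd)
    refine attracts_succ_of_mem ht (v := s.robber) (by rwa [ht]) ?_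
    change (s.step _).pos _ = (s.step _).robber
    rw [s.step_robber_of_ne _ (ht ▸ (Fin.castSucc_lt_last m).ne), ← ht, s.step_pos_turn]
  | succ d ih =>
    have hm := m.isLt
    have hl : s.turn ≠ Fin.last c := ne_last_of_val_lt (by omega)
    have hne : s.turn ≠ m.castSucc := by
      intro h; have := congrArg Fin.val h; simp at this; omega
    refine attracts_succ_of_notMem hne fun v _ => ih _ ?_ ?_
    · rw [s.step_turn, val_add_one hl]; omega
    · rwa [s.step_pos_of_ne v hne.symm, s.step_robber_of_ne v hl]

/-- The bound counts the robber's turn, the `m.val` cops before cop `m`, and his own move. -/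
theorem catchesWithin_of_trapped {w : V} (hs : IsLeafAt G s.robber w) (ht : s.turn = Fin.last c)
    (h : s.pos m.castSucc = w) : CatchesWithin G m (m.val + 2) s := by
  have hne : s.turn ≠ m.castSucc := ht ▸ (Fin.castSucc_lt_last m).ne'
  refine attracts_succ_of_notMem hne fun v hv => ?_
  rw [ht] at hv
  have hp := s.step_pos_of_ne v hne.symm
  have hr := s.step_robber v ht
  rcases hs.legal hv with rfl | rfl
  · refine catchesWithin_of_legal m.val _ ?_ ?_
    · rw [s.step_turn, ht]; simp
    · rw [hp, hr, h]; exact Or.inr hs.adj.symm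
  · refine Attracts.of_target ?_
    rw [hp, hr, h]

theorem catchesWithin_of_guarding (e : ℕ) (s : State V c) {w : V} (hs : IsLeafAt G s.robber w)
    (he : s.turn.val + e = c) (h : s.pos m.castSucc = w) :
    CatchesWithin G m (e + (m.val + 2)) s := by
  induction e generalizing s with
  | zero =>
    rw [Nat.zero_add]
    exact catchesWithin_of_trapped hs (Fin.ext (by simpa using he)) h
  | succ e ih =>
    have hl : s.turn ≠ Fin.last c := ne_last_of_val_lt (by omega)
    have key : ∀ v, (s.step v).pos m.castSucc = w →
        CatchesWithin G m (e + (m.val + 2)) (s.step v) := fun v hv =>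
      ih _ (by rwa [s.step_robber_of_ne v hl]) (by rw [s.step_turn, val_add_one hl]; omega) hv
    rw [show e + 1 + (m.val + 2) = e + (m.val + 2) + 1 by omega]
    by_cases ht : s.turn = m.castSucc
    · exact attracts_succ_of_mem ht (Legal.refl _) (key _ (by rw [← ht, s.step_pos_turn, ht, h]))
    · exact attracts_succ_of_notMem ht fun v _ =>
        key v (by rw [s.step_pos_of_ne v (Ne.symm ht), h])

/-- After `d` turns cop `m` moves to `w`, waits `c - (m.val + 1)` turns for the robber's turn, and
then needs `m.val + 2` more. -/
theorem catchesWithin_of_approaching (d : ℕ) (s : State V c) {w : V} (hs : IsLeafAt G s.robber w)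
    (hd : s.turn.val + d = m.val) (h : Legal G (s.pos m.castSucc) w) :
    CatchesWithin G m (d + c + 2) s := by
  have hm := m.isLt
  induction d generalizing s with
  | zero =>
    have ht : s.turn = m.castSucc := Fin.ext (by simpa using hd)
    have hl : s.turn ≠ Fin.last c := ne_last_of_val_lt (by omega)
    refine attracts_succ_of_mem ht (v := w) (by rwa [ht]) ?_
    refine (catchesWithin_of_guarding (c - (m.val + 1)) (s.step w) (w := w)
      (by rwa [s.step_robber_of_ne w hl]) ?_ ?_).mono (by omega)
    · rw [s.step_turn, val_add_one hl]; omega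
    · rw [← ht, s.step_pos_turn]
  | succ d ih =>
    have hl : s.turn ≠ Fin.last c := ne_last_of_val_lt (by omega)
    have hne : s.turn ≠ m.castSucc := by
      intro h; have := congrArg Fin.val h; simp at this; omega
    rw [show d + 1 + c + 2 = d + c + 2 + 1 by omega]
    refine attracts_succ_of_notMem hne fun v _ => ih _ ?_ ?_ ?_
    · rwa [s.step_robber_of_ne v hl]
    · rw [s.step_turn, val_add_one hl]; omega
    · rwa [s.step_pos_of_ne v hne.symm]

theorem catchesWithin_of_close {w : V} (hs : IsLeafAt G s.robber w) (ht : s.turn = Fin.last c)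
    (h : Legal G (s.pos m.castSucc) w) : CatchesWithin G m (m.val + c + 3) s := by
  have hne : s.turn ≠ m.castSucc := ht ▸ (Fin.castSucc_lt_last m).ne'
  refine attracts_succ_of_notMem hne fun v hv => ?_
  rw [ht] at hv
  have hp := s.step_pos_of_ne v hne.symm
  have hr := s.step_robber v ht
  have h0 : (s.step v).turn.val + m.val = m.val := by rw [s.step_turn, ht]; simp
  rcases hs.legal hv with rfl | rfl
  · exact catchesWithin_of_approaching m.val _ (w := w) (by rwa [hr]) h0 (by rwa [hp])
  · exact (catchesWithin_of_legal m.val _ h0 (by rwa [hp, hr])).mono (by omega)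

/-- If optimal play ends before the next move of the robber, then the capturing cop is next to the
robber. -/
theorem IsFinisher.legal_of_val_add [Finite V] (h : IsFinisher G n m s)
    (hn : s.turn.val + n = m.val + 1) : Legal G (s.pos m.castSucc) s.robber := by
  have hm := m.isLt
  induction n generalizing s with
  | zero => obtain ⟨k, hk⟩ := h.pos; omega
  | succ n ih =>
    have hl : s.turn ≠ Fin.last c := ne_last_of_val_lt (by omega)
    obtain ⟨v, hv, hg⟩ := exists_greedyMove (G := G) h.not_isCapture
    have hr := h.rank.step h.not_isCapture hv hg
    cases n with
    | zero =>
      have := (State.step_capturing_iff h.not_isCapture h.turn_eq hr.1 m).2 rfl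
      rw [← h.turn_eq, s.step_pos_turn, s.step_robber_of_ne v hl] at this
      rw [← h.turn_eq, ← this]; exact hv
    | succ n =>
      have hne : m.castSucc ≠ s.turn := by
        intro h; have := congrArg Fin.val h; simp at this; omega
      have := ih (h.step hr) (by rw [s.step_turn, val_add_one hl]; omega)
      rwa [s.step_pos_of_ne v hne, s.step_robber_of_ne v hl] at this

/-- If the robber stays, some cop `k ≤ m` next to the leaf, hence at `w`, captures within the round.
Minimality of the rank gives `k = m`. -/
theorem IsFinisher.pos_eq_of_eq [Finite V] (h : IsFinisher G n m s) (ht : s.turn = Fin.last c)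
    (hn : n = m.val + 2) {w : V} (hw : IsLeafAt G s.robber w) : s.pos m.castSucc = w := by
  subst hn
  have hm := m.isLt
  have hstay := h.rank.1.forall_of_notMem h.not_isCapture (by simp [ht]) (Legal.refl _)
  obtain ⟨r, k, hk⟩ := exists_isFinisher (fun he => he _ hstay)
    (State.not_isCapture_stay h.not_isCapture)
  have hr := hk.rank.le hstay
  have h0 : (s.step (s.pos s.turn)).turn.val = 0 := by rw [s.step_turn, ht]; simp
  have hkr := hk.val_add_eq (by omega)
  have hkp := hk.legal_of_val_add hkr
  rw [s.step_robber _ ht, s.step_pos_of_ne _ (ht ▸ (Fin.castSucc_lt_last k).ne), ht] at hkp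
  have hkw : s.pos k.castSucc = w := by
    rcases hkp with hkp | hkp
    · exact absurd ⟨k, hkp.symm⟩ h.not_isCapture
    · exact (hw _).1 hkp.symm
  have hle := h.rank.le (catchesWithin_of_trapped hw ht hkw).capturesWithin
  rwa [show m = k from Fin.ext (by omega)]

/-- The capturing cop does not need the other cops. -/
theorem IsFinisher.catchesWithin [Finite V] (hG : G.Connected) (hc : 2 ≤ c)
    (hγ : γ ∈ Set.Ioo (0 : ℝ) 1) (hG3 : ClassG3 G c γ 0) (h : IsFinisher G n m s) :
    CatchesWithin G m n s := by
  have hm := m.isLt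
  induction n generalizing s with
  | zero => obtain ⟨k, hk⟩ := h.pos; omega
  | succ n ih =>
    by_cases ht : s.turn = Fin.last c
    · obtain ⟨w, hw, hleg⟩ := h.exists_isLeafAt hG hc hγ hG3 ht
      -- The rank is either that of a cop already at `w`, or at least what a lone cop at distance at
      -- most one from `w` needs.
      rcases h.eq_or_le ht with hn | hn
      · exact (catchesWithin_of_trapped hw ht (h.pos_eq_of_eq ht hn hw)).mono hn.ge
      · exact (catchesWithin_of_close hw ht hleg).mono hn
    · obtain ⟨v, hv, hg⟩ := exists_greedyMove (G := G) h.not_isCapture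
      have hr := h.rank.step h.not_isCapture hv hg
      cases n with
      | zero =>
        refine attracts_succ_of_mem h.turn_eq hv ?_
        exact (State.step_capturing_iff h.not_isCapture h.turn_eq hr.1 m).2 rfl
      | succ n =>
        have h1 := ih (h.step hr)
        by_cases htm : s.turn = m.castSucc
        · exact attracts_succ_of_mem htm hv h1
        -- The greedy move of another cop may be replaced by any move, since neither `m` nor the
        -- robber is affected.
        · exact attracts_succ_of_notMem htm fun v' _ =>
            h1.congr (agreeFor_step_step ⟨rfl, rfl, rfl⟩ htm ht v v')

end Scar

namespace Scar

variable {V : Type*} {G : SimpleGraph V} {c : ℕ} {s : State V c} {n : ℕ} {γ : ℝ} {m : Fin c}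

/-! ### Greedy profiles in the selfish games -/

theorem le_reward (h : s.pos m.castSucc = s.robber) : 1 / (c : ℝ) ≤ reward 0 m.castSucc s := by
  have hm : m.castSucc ≠ Fin.last c := (Fin.castSucc_lt_last m).ne
  unfold reward
  rw [if_neg hm]
  split_ifs
  · exact le_rfl
  · have h1 : 0 < s.numCapturing := by
      have : Nonempty {i : Fin c // s.pos i.castSucc = s.robber} := ⟨⟨m, h⟩⟩
      exact Nat.card_pos
    have h2 : s.numCapturing ≤ c := by
      simpa [State.numCapturing] using
        Finite.card_subtype_le (fun i : Fin c => s.pos i.castSucc = s.robber)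
    rw [sub_zero]
    exact one_div_le_one_div_of_le (by exact_mod_cast h1) (by exact_mod_cast h2)

theorem numCapturing_eq_one (h : ∀ i : Fin c, s.pos i.castSucc = s.robber ↔ i = m) :
    s.numCapturing = 1 := by
  unfold State.numCapturing
  rw [Nat.card_congr (Equiv.subtypeEquivRight h)]
  simp

theorem reward_of_pos_iff (hc : 2 ≤ c) (h : ∀ i : Fin c, s.pos i.castSucc = s.robber ↔ i = m)
    (k : Fin c) : reward 0 k.castSucc s = if k = m then 1 else 0 := by
  unfold reward
  rw [if_neg (Fin.castSucc_lt_last k).ne, numCapturing_eq_one h, if_neg (by omega)]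
  simp [h]

/-- Even a bad robber move does not pass the finishing role to another cop; it only lowers the rank,
unless he steps onto cop `m`. -/
theorem IsFinisher.robber_step [Finite V] (hG : G.Connected) (hc : 2 ≤ c)
    (hγ : γ ∈ Set.Ioo (0 : ℝ) 1) (hG3 : ClassG3 G c γ 0) (h : IsFinisher G n m s)
    (ht : s.turn = Fin.last c) {v : V} (hv : Legal G (s.pos s.turn) v) :
    (s.pos m.castSucc = v ∧ 2 ≤ n) ∨ ∃ n' < n, IsFinisher G n' m (s.step v) := by
  obtain ⟨w, hw, hleg⟩ := h.exists_isLeafAt hG hc hγ hG3 ht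
  have hm := m.isLt
  have hn := h.eq_or_le ht
  have hpos : ∀ (k : Fin c) v, (s.step v).pos k.castSucc = s.pos k.castSucc := fun k v =>
    s.step_pos_of_ne v (ht ▸ (Fin.castSucc_lt_last k).ne)
  have h0 : ∀ v, (s.step v).turn.val = 0 := fun v => by rw [s.step_turn, ht]; simp
  obtain ⟨l, rfl⟩ : ∃ l, n = l + 1 + 1 := ⟨n - 2, by omega⟩
  have hlegw : Legal G (s.pos s.turn) w := by rw [ht]; exact Or.inr hw.adj
  by_cases hvw : v = w
  · subst hvw
    rcases hn with hn | hn
    · left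
      exact ⟨h.pos_eq_of_eq ht hn hw, by omega⟩
    · by_cases hp : s.pos m.castSucc = v
      · exact Or.inl ⟨hp, by omega⟩
      right
      have hcw : CatchesWithin G m (m.val + 1) (s.step v) :=
        catchesWithin_of_legal m.val _ (by rw [h0]; omega)
          (by rw [hpos, s.step_robber v ht]; exact hleg)
      have hncap : ¬ (s.step v).IsCapture := by
        rintro ⟨k, hk⟩
        rw [hpos, s.step_robber v ht] at hk
        have := h.rank.le (catchesWithin_of_trapped hw ht hk).capturesWithin
        have := k.isLt
        omega
      obtain ⟨r, k, hk⟩ := exists_isFinisher (fun he => he _ hcw.capturesWithin) hncap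
      have hr := hk.rank.le hcw.capturesWithin
      have hkr := hk.val_add_eq (by rw [h0]; omega)
      have hkp := hk.legal_of_val_add hkr
      rw [s.step_robber _ ht, hpos] at hkp
      rw [h0] at hkr
      -- A cop `k` before `m` in the order who is next to `w` would have made the rank at `s`
      -- smaller.
      have hle := h.rank.le (catchesWithin_of_close hw ht hkp).capturesWithin
      obtain rfl : k = m := Fin.ext (by omega)
      exact ⟨r, by omega, hk⟩
  · right
    refine ⟨l + 1, Nat.lt_succ_self _, h.step ?_⟩
    have hc1 := h.rank.1.forall_of_notMem h.not_isCapture (by simp [ht]) hv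
    -- Stepping to `w` is no better than staying, so staying is greedy and lowers the rank by
    -- exactly one.
    have hcw : CapturesWithin G l (s.step w) := by
      by_cases hp : s.pos m.castSucc = w
      · exact Attracts.of_target ⟨m, by rw [hpos, s.step_robber w ht, hp]⟩
      · have hcw : CatchesWithin G m (m.val + 1) (s.step w) :=
          catchesWithin_of_legal m.val _ (by rw [h0]; omega)
            (by rw [hpos, s.step_robber w ht]; exact hleg)
        refine hcw.capturesWithin.mono ?_
        rcases hn with hn | hn
        · exact absurd (h.pos_eq_of_eq ht hn hw) hp
        · omega
    refine ⟨hc1, fun k hk hck => h.rank.2 (l + 1) (Nat.lt_succ_self _)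
      (attracts_succ_of_notMem (by simp [ht]) fun u hu => ?_)⟩
    rw [ht] at hu hv
    rcases hw.legal hu with rfl | rfl
    · rcases hw.legal hv with rfl | rfl
      · exact hck.mono (by omega)
      · exact absurd rfl hvw
    · exact hcw

/-- The other cops cannot disturb the capturing cop. -/
theorem IsFinisher.cop_step [Finite V] (hG : G.Connected) (hc : 2 ≤ c)
    (hγ : γ ∈ Set.Ioo (0 : ℝ) 1) (hG3 : ClassG3 G c γ 0) (h : IsFinisher G (n + 1) m s)
    (ht : s.turn ≠ Fin.last c) {v : V} (hv : Legal G (s.pos s.turn) v)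
    (hg : s.turn = m.castSucc → GreedyMove G s v) : CaptureRank G n (s.step v) := by
  by_cases hm : s.turn = m.castSucc
  · exact h.rank.step h.not_isCapture hv (hg hm)
  · have h1 : CatchesWithin G m n (s.step v) := (h.catchesWithin hG hc hγ hG3).forall_of_notMem
      (fun hp => h.not_isCapture ⟨m, hp⟩) hm hv
    exact ⟨h1.capturesWithin, fun j hj hcj => h.rank.2 (j + 1) (by omega)
      (attracts_succ_of_mem (A := {k | k ≠ Fin.last c}) ht hv hcj)⟩

theorem IsFinisher.pow_le_payoff [Finite V] (hG : G.Connected) (hc : 2 ≤ c)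
    (hγ : γ ∈ Set.Ioo (0 : ℝ) 1) (hγc : γ ≤ 1 / (c : ℝ)) (hG3 : ClassG3 G c γ 0)
    (h : IsFinisher G n m s) {σ : PosProfile G c} (hσ : (σ m.castSucc).IsGreedy) :
    γ ^ n ≤ payoff γ 0 m.castSucc s σ.toProfile := by
  induction n using Nat.strong_induction_on generalizing s with
  | _ n ih =>
    have hs := h.not_isCapture
    have hlegal : Legal G (s.pos s.turn) ((σ s.turn).move s) := (σ _).legal s rfl
    have hnext : ∀ n' < n, IsFinisher G n' m (σ.next s) →
        γ ^ n ≤ γ * payoff γ 0 m.castSucc (σ.next s) σ.toProfile := by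
      intro n' hn' h'
      refine le_trans ?_ (mul_le_mul_of_nonneg_left (ih n' hn' h') hγ.1.le)
      rw [← pow_succ']
      exact pow_le_pow_of_le_one hγ.1.le hγ.2.le hn'
    rw [payoff_of_not_isCapture _ hs]
    obtain ⟨k, rfl⟩ := h.pos
    by_cases ht : s.turn = Fin.last c
    · rcases h.robber_step hG hc hγ hG3 ht hlegal with ⟨hp, h2⟩ | ⟨n', hn', h'⟩
      · have hp' : (σ.next s).pos m.castSucc = (σ.next s).robber := by
          unfold PosProfile.next
          rw [s.step_robber _ ht, s.step_pos_of_ne _ (ht ▸ (Fin.castSucc_lt_last m).ne), hp]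
        rw [payoff_of_isCapture _ ⟨m, hp'⟩]
        -- The robber steps onto cop `m`. This is where γ ≤ 1/c is needed: the shared reward is at
        -- least 1/c, and an undisturbed capture would have taken at least two turns.
        calc γ ^ (k + 1) ≤ γ ^ 2 := pow_le_pow_of_le_one hγ.1.le hγ.2.le h2
          _ = γ * γ := sq γ
          _ ≤ γ * reward 0 m.castSucc (σ.next s) :=
            mul_le_mul_of_nonneg_left (hγc.trans (le_reward hp')) hγ.1.le
      · exact hnext n' hn' h'
    · have hr : CaptureRank G k (σ.next s) :=
        h.cop_step hG hc hγ hG3 ht hlegal fun hm => by rw [hm]; exact hσ s hs hm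
      cases k with
      | zero =>
        have := State.step_capturing_iff hs h.turn_eq hr.1
        rw [payoff_of_isCapture _ hr.1]
        unfold PosProfile.next
        rw [reward_of_pos_iff hc this, if_pos rfl]
        simp
      | succ k => exact hnext _ (Nat.lt_succ_self _) (h.step hr)

/-- With a greedy robber the finisher makes the last move himself and captures alone, so no other
cop gets a share. -/
theorem IsFinisher.payoff_eq_zero [Finite V] (hG : G.Connected) (hc : 2 ≤ c)
    (hγ : γ ∈ Set.Ioo (0 : ℝ) 1) (hG3 : ClassG3 G c γ 0)
    (h : IsFinisher G n m s) {σ : PosProfile G c} (hσ : (σ m.castSucc).IsGreedy)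
    (hσl : (σ (Fin.last c)).IsGreedy) {k : Fin c} (hk : k ≠ m) :
    payoff γ 0 k.castSucc s σ.toProfile = 0 := by
  induction n generalizing s with
  | zero => obtain ⟨j, hj⟩ := h.pos; omega
  | succ n ih =>
    have hs := h.not_isCapture
    have hlegal : Legal G (s.pos s.turn) ((σ s.turn).move s) := (σ _).legal s rfl
    have hr : CaptureRank G n (σ.next s) := by
      by_cases ht : s.turn = Fin.last c
      · refine h.rank.step hs hlegal ?_
        rw [ht]
        exact hσl s hs ht
      · exact h.cop_step hG hc hγ hG3 ht hlegal fun hm => by rw [hm]; exact hσ s hs hm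
    rw [payoff_of_not_isCapture _ hs]
    cases n with
    | zero =>
      have := State.step_capturing_iff hs h.turn_eq hr.1
      rw [payoff_of_isCapture _ hr.1]
      unfold PosProfile.next
      rw [reward_of_pos_iff hc this, if_neg hk, mul_zero]
    | succ n => rw [show payoff γ 0 k.castSucc (σ.next s) σ.toProfile = 0 from ih (h.step hr),
        mul_zero]

/-- At noncapture states the value for a cop is γ^n if he is the finisher at rank n, and 0
otherwise; greedy play guarantees it to both sides. -/
theorem isOptimalProfile_of_greedy [Finite V] (hG : G.Connected) (hc : 2 ≤ c)
    (hγ : γ ∈ Set.Ioo (0 : ℝ) 1) (hγc : γ ≤ 1 / (c : ℝ)) (hG3 : ClassG3 G c γ 0)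
    {σ : PosProfile G c} (hσ : ∀ n, (σ n).IsGreedy) (k : Fin (c + 1)) :
    IsOptimalProfile γ 0 k σ := by
  induction k using Fin.lastCases with
  | last => exact isOptimalProfile_last_of_greedy hγ hσ
  | cast k =>
    have hself : ∀ ρ : PosProfile G c, ((Function.update ρ k.castSucc (σ k.castSucc) :
        PosProfile G c) k.castSucc).IsGreedy := fun ρ => by
      rw [Function.update_self]; exact hσ _
    have hother : ∀ (α : PosStrategy G c k.castSucc) (j : Fin (c + 1)), j ≠ k.castSucc →
        ((Function.update σ k.castSucc α : PosProfile G c) j).IsGreedy := fun α j hj => by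
      rw [Function.update_of_ne hj]; exact hσ _
    have hl : Fin.last c ≠ k.castSucc := (Fin.castSucc_lt_last k).ne'
    refine isOptimalProfile_of_forall hγ _ _ fun s => ?_
    by_cases hs : s.IsCapture
    · exact ⟨reward 0 k.castSucc s, fun ρ => (payoff_of_isCapture _ hs).ge,
        fun α => (payoff_of_isCapture _ hs).le⟩
    by_cases he : Escapes G s
    · exact ⟨0, fun ρ => payoff_nonneg hγ _ _ _, fun α =>
        (payoff_eq_zero_of_escapes hγ (hother α _ hl) _ he).le⟩
    obtain ⟨n, m, h⟩ := exists_isFinisher he hs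
    by_cases hkm : k = m
    · subst hkm
      refine ⟨γ ^ n, fun ρ => h.pow_le_payoff hG hc hγ hγc hG3 (hself ρ), fun α => ?_⟩
      obtain ⟨j, rfl⟩ := h.pos
      exact (abs_le.1 (abs_payoff_le_of_greedy_robber hγ (hother α _ hl) _
        (h.rank.2 j (Nat.lt_succ_self j)))).2
    · exact ⟨0, fun ρ => payoff_nonneg hγ _ _ _, fun α =>
        (h.payoff_eq_zero hG hc hγ hG3
          (hother α _ (fun h => hkm (Fin.castSucc_injective _ h).symm)) (hother α _ hl) hkm).le⟩

end Scar

namespace Scar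

variable {V : Type*} {G : SimpleGraph V} {c : ℕ} {s : State V c} {n : ℕ} {γ : ℝ} {m : Fin c}

/-! ### All cops next to a robber at a leaf -/

/-- The state in which all cops are at `w`, the robber is at `x`, and token `t` has the move. -/
def gathered (w x : V) (t : Fin (c + 1)) : State V c := ⟨Fin.snoc (α := fun _ => V) (fun _ => w) x, t⟩

theorem gathered_pos (w x : V) (t : Fin (c + 1)) (i : Fin c) :
    (gathered w x t).pos i.castSucc = w := by
  simp only [gathered, Fin.snoc_castSucc]

theorem gathered_pos_last (w x : V) (t : Fin (c + 1)) : (gathered w x t).pos (Fin.last c) = x := by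
  simp only [gathered, Fin.snoc_last]

theorem gathered_robber (w x : V) (t : Fin (c + 1)) : (gathered w x t).robber = x :=
  gathered_pos_last w x t

theorem gathered_not_isCapture {w x : V} (h : w ≠ x) (t : Fin (c + 1)) :
    ¬ (gathered w x t).IsCapture := by
  rintro ⟨i, hi⟩
  rw [gathered_pos, gathered_robber] at hi
  exact h hi

theorem gathered_stay (w x : V) (t : Fin (c + 1)) :
    (gathered w x t).step ((gathered w x t).pos t) = gathered w x (t + 1) :=
  State.step_stay _

theorem gathered_step_last (w x v : V) (i : Fin c) :
    ((gathered w x (Fin.last c)).step v).pos i.castSucc = w := by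
  rw [State.step_pos_of_ne _ _ (Fin.castSucc_lt_last i).ne, gathered_pos]

/-- Lying outside 𝒢₂ supplies a noncapture state with the robber to move from which he cannot
escape. -/
theorem exists_leaf [Finite V] (hG : G.Connected) (hc : 2 ≤ c) (hγ : γ ∈ Set.Ioo (0 : ℝ) 1)
    (hG3 : ClassG3 G c γ 0) : ∃ x w, IsLeafAt G x w := by
  have h := hG3.1.2
  simp only [ClassG2, not_and] at h
  have h := h hG3.1.1.1
  push Not at h
  obtain ⟨s, hs, ht, hne⟩ := h
  obtain ⟨n, m, hm⟩ := exists_isFinisher (G := G) (fun he => hne (stateCopNumber_eq_top he)) hs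
  obtain ⟨w, hw, -⟩ := hm.exists_isLeafAt hG hc hγ hG3 ht
  exact ⟨_, w, hw⟩

theorem PosStrategy.IsGreedy.move_gathered {x w : V} (hw : IsLeafAt G x w) (hc : 0 < c)
    {σ : PosStrategy G c (Fin.last c)} (hσ : σ.IsGreedy) :
    σ.move (gathered w x (Fin.last c)) = x := by
  have hs : ¬ (gathered w x (Fin.last c)).IsCapture := gathered_not_isCapture hw.adj.ne' _
  have hleg := σ.legal (gathered w x (Fin.last c)) rfl
  rw [gathered_pos_last] at hleg
  refine (hw.legal hleg).resolve_right fun h => ?_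
  refine (hσ _ hs rfl).2 rfl 0 (not_captureRank_one_of_robber hs rfl) ?_
  rw [h]
  exact ⟨⟨0, hc⟩, by rw [gathered_step_last, State.step_robber _ _ rfl]⟩

open Classical in
/-- Go to the robber whenever possible. -/
noncomputable def pounce (G : SimpleGraph V) (k : Fin (c + 1)) : PosStrategy G c k :=
  ⟨fun s => if Legal G (s.pos k) s.robber then s.robber else s.pos k, fun s _ => by
    split_ifs with h
    · exact h
    · exact Legal.refl _⟩

open Classical in
/-- Go to the vertex `w` whenever possible. -/
noncomputable def goTo (G : SimpleGraph V) (w : V) (k : Fin (c + 1)) : PosStrategy G c k :=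
  ⟨fun s => if Legal G (s.pos k) w then w else s.pos k, fun s _ => by
    split_ifs with h
    · exact h
    · exact Legal.refl _⟩

theorem posPayoff_pounce (hc : 2 ≤ c) (hs : ¬ s.IsCapture) (ht : s.turn = m.castSucc)
    (h : Legal G (s.pos m.castSucc) s.robber) (φ : PosProfile G c) :
    posPayoff γ 0 m.castSucc s (pounce G _) φ = γ := by
  unfold posPayoff
  have hnext : PosProfile.next (Function.update φ m.castSucc (pounce G _)) s = s.step s.robber := by
    unfold PosProfile.next
    rw [ht, Function.update_self]
    simp [pounce, h]
  have hcap : (s.step s.robber).IsCapture := by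
    refine ⟨m, ?_⟩
    rw [State.step_robber_of_ne _ _ (ht ▸ (Fin.castSucc_lt_last m).ne), ← ht, State.step_pos_turn]
  rw [payoff_of_not_isCapture _ hs, hnext, payoff_of_isCapture _ hcap,
    reward_of_pos_iff hc (State.step_capturing_iff hs ht hcap), if_pos rfl, mul_one]

theorem numCapturing_eq (h : ∀ i : Fin c, s.pos i.castSucc = s.robber) : s.numCapturing = c := by
  unfold State.numCapturing
  rw [Nat.card_congr (Equiv.subtypeUnivEquiv h), Nat.card_fin]

/-- For `γ > 1 / c`, the robber surrenders to all cops at once in order to harm the first cop. -/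
theorem IsOptimalProfile.move_gathered (hc : 2 ≤ c) (hγ : γ ∈ Set.Ioo (0 : ℝ) 1)
    (hγc : 1 / (c : ℝ) < γ) {x w : V} (hw : IsLeafAt G x w) (hm : m.val = 0)
    {φ : PosProfile G c} (hφ : IsOptimalProfile γ 0 m.castSucc φ) :
    (φ (Fin.last c)).move (gathered w x (Fin.last c)) = w := by
  have hs : ¬ (gathered w x (Fin.last c) : State V c).IsCapture :=
    gathered_not_isCapture hw.adj.ne' _
  have hl : Fin.last c ≠ m.castSucc := (Fin.castSucc_lt_last m).ne'
  have hleg := (φ (Fin.last c)).legal (gathered w x (Fin.last c)) rfl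
  rw [gathered_pos_last] at hleg
  refine (hw.legal hleg).resolve_left fun h => ?_
  -- If the robber stays, the first cop moves next and captures alone at time 2.
  have h1 : posPayoff γ 0 m.castSucc (gathered w x (Fin.last c)) (pounce G _) φ = γ * γ := by
    unfold posPayoff
    have hnext : PosProfile.next (Function.update φ m.castSucc (pounce G _))
        (gathered w x (Fin.last c)) = gathered w x m.castSucc := by
      unfold PosProfile.next
      rw [show (gathered w x (Fin.last c) : State V c).turn = Fin.last c from rfl,
        Function.update_of_ne hl, h]
      conv_lhs => arg 2; rw [← gathered_pos_last w x (Fin.last c)]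
      rw [gathered_stay]
      congr 1
      exact Fin.ext (by simp [hm])
    rw [payoff_of_not_isCapture _ hs, hnext]
    congr 1
    refine posPayoff_pounce hc (gathered_not_isCapture hw.adj.ne' _) rfl ?_ φ
    rw [gathered_pos, gathered_robber]
    exact Or.inr hw.adj.symm
  have : Nonempty (PosStrategy G c m.castSucc) := ⟨φ _⟩
  -- If the robber goes to `w`, all `c` cops share the capture at time 1.
  have h2 : value G γ 0 m.castSucc (gathered w x (Fin.last c)) ≤ γ * (1 / (c : ℝ)) := by
    refine value_le_of_forall_exists hγ _ _ fun α => ⟨goTo G w, le_of_eq ?_⟩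
    unfold posPayoff
    have hnext : PosProfile.next (Function.update (goTo G w) m.castSucc α)
        (gathered w x (Fin.last c)) = (gathered w x (Fin.last c)).step w := by
      unfold PosProfile.next
      rw [show (gathered w x (Fin.last c) : State V c).turn = Fin.last c from rfl,
        Function.update_of_ne hl]
      have hleg : Legal G ((gathered w x (Fin.last c)).pos (Fin.last c)) w := by
        rw [gathered_pos_last]; exact Or.inr hw.adj
      simp only [goTo, if_pos hleg]
    have hall : ∀ i : Fin c, ((gathered w x (Fin.last c)).step w).pos i.castSucc =
        ((gathered w x (Fin.last c)).step w).robber := fun i => by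
      rw [gathered_step_last, State.step_robber _ _ rfl]
    rw [payoff_of_not_isCapture _ hs, hnext, payoff_of_isCapture _ ⟨m, hall m⟩]
    unfold reward
    rw [if_neg (Fin.castSucc_lt_last m).ne, if_pos (numCapturing_eq hall)]
  have h3 := (h1.symm.le.trans (hφ.2 _ _)).trans h2
  exact absurd (le_of_mul_le_mul_left h3 hγ.1) (not_le.2 hγc)

/-- An immediate solo capture pays γ, while any delay pays at most γ². -/
theorem IsOptimalProfile.isCapture_step_of_legal (hc : 2 ≤ c) (hγ : γ ∈ Set.Ioo (0 : ℝ) 1)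
    {φ : PosProfile G c} (hφ : IsOptimalProfile γ 0 m.castSucc φ) (hs : ¬ s.IsCapture)
    (ht : s.turn = m.castSucc) (h : Legal G (s.pos m.castSucc) s.robber) :
    (s.step ((φ m.castSucc).move s)).IsCapture := by
  by_contra hno
  have h1 := (posPayoff_pounce (γ := γ) hc hs ht h φ).symm.le.trans (hφ.2 s _)
  have h2 := h1.trans (hφ.1 s φ)
  unfold posPayoff at h2
  rw [Function.update_eq_self, payoff_of_not_isCapture _ hs] at h2
  have h3 : PosProfile.next φ s = s.step ((φ m.castSucc).move s) := by
    unfold PosProfile.next; rw [ht]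
  rw [h3] at h2
  have h4 := mul_le_mul_of_nonneg_left (abs_le.1 (abs_payoff_le hγ m.castSucc φ hno)).2 hγ.1.le
  have h5 := mul_lt_of_lt_one_right hγ.1 hγ.2
  linarith

/-! ### Necessity of γ ≤ 1/c -/

theorem firstDeviator_cons_of_eq_some {φ : Fin (c + 1) → PosProfile G c} {k j : Fin (c + 1)}
    {h : List (State V c)} {x : State V c} (hx : firstDeviator φ k h x = some j) (s : State V c) :
    firstDeviator φ k (x :: h) s = some j := by
  simp [firstDeviator, hx]

/-- All cops stay at `w`, although the first one could capture. -/
theorem exists_history_of_deviation (hc : 2 ≤ c) (hγ : γ ∈ Set.Ioo (0 : ℝ) 1) {x w : V}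
    (hw : IsLeafAt G x w) (hm : m.val = 0) {φ : Fin (c + 1) → PosProfile G c}
    (hφ : IsOptimalProfile γ 0 m.castSucc (φ m.castSucc)) :
    ∃ s₀ h, NCHistory G s₀ h (gathered w x (Fin.last c)) ∧
      firstDeviator φ (Fin.last c) h (gathered w x (Fin.last c)) = some m.castSucc := by
  have hnc := fun t : Fin (c + 1) => gathered_not_isCapture hw.adj.ne' t
  have hmove : ∀ {h : List (State V c)} {t}, NCHistory G (gathered w x m.castSucc) h
      (gathered w x t) → NCHistory G (gathered w x m.castSucc) (gathered w x t :: h)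
        (gathered w x (t + 1)) := by
    intro h t hh
    rw [← gathered_stay]
    exact hh.move _ (Legal.refl _) (by rw [gathered_stay]; exact hnc _)
  have key : ∀ d : ℕ, d < c → ∀ t : Fin (c + 1), t.val = d + 1 →
      ∃ h, NCHistory G (gathered w x m.castSucc) h (gathered w x t) ∧
        firstDeviator φ (Fin.last c) h (gathered w x t) = some m.castSucc := by
    intro d
    induction d with
    | zero =>
      intro _ t ht
      obtain rfl : t = m.castSucc + 1 := Fin.ext (by rw [castSucc_add_one_val, hm, ht])
      refine ⟨_, hmove (NCHistory.start (hnc _)), ?_⟩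
      have hne : w ≠ ((φ m.castSucc) m.castSucc).move (gathered w x m.castSucc) := by
        intro h
        have := hφ.isCapture_step_of_legal hc hγ (hnc m.castSucc) rfl (by
          rw [gathered_pos, gathered_robber]; exact Or.inr hw.adj.symm)
        rw [← h] at this
        conv at this => arg 1; arg 2; rw [← gathered_pos w x m.castSucc m]
        rw [gathered_stay] at this
        exact hnc _ this
      have hl : m.castSucc ≠ Fin.last c := (Fin.castSucc_lt_last m).ne
      simp only [firstDeviator]
      rw [if_pos]
      · rfl
      · refine ⟨hl, ?_⟩
        change (gathered w x (m.castSucc + 1)).pos m.castSucc ≠ _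
        rw [gathered_pos]
        exact hne
    | succ d ih =>
      intro hd t ht
      obtain ⟨h, h1, h2⟩ := ih (by omega) ⟨d + 1, by omega⟩ rfl
      have : t = ⟨d + 1, by omega⟩ + 1 := Fin.ext (by
        rw [val_add_one (ne_last_of_val_lt (by simpa using hd)), ht])
      rw [this]
      exact ⟨_, hmove h1, firstDeviator_cons_of_eq_some h2 _⟩
  obtain ⟨h, h1, h2⟩ := key (c - 1) (by omega) (Fin.last c) (by rw [Fin.val_last]; omega)
  exact ⟨_, h, h1, h2⟩

theorem le_one_div_of_isPositional [Finite V] (hG : G.Connected) (hc : 2 ≤ c)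
    (hγ : γ ∈ Set.Ioo (0 : ℝ) 1) (hG3 : ClassG3 G c γ 0) {φ : Fin (c + 1) → PosProfile G c}
    (hφ : IsTriggerFamily γ 0 φ) (hpos : IsPositional (trigger φ)) : γ ≤ 1 / (c : ℝ) := by
  by_contra! hγc
  obtain ⟨x, w, hw⟩ := exists_leaf hG hc hγ hG3
  let m : Fin c := ⟨0, by omega⟩
  have hm : m.val = 0 := rfl
  obtain ⟨f, hf⟩ := hpos (Fin.last c)
  obtain ⟨s₀, h, h1, h2⟩ := exists_history_of_deviation hc hγ hw hm (hφ m.castSucc)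
  have e1 := hf _ _ _ h1 rfl
  have e2 := hf _ _ _ (NCHistory.start (G := G) (gathered_not_isCapture hw.adj.ne' _)) rfl
  have hx : ((φ (Fin.last c)) (Fin.last c)).move (gathered w x (Fin.last c)) = x :=
    (IsCROptimal.isGreedy hγ ⟨_, hφ (Fin.last c), rfl⟩).move_gathered hw (by omega)
  have hw' := (hφ m.castSucc).move_gathered hc hγ hγc hw hm
  simp only [trigger, h2, Option.getD_some, firstDeviator, Option.getD_none, hw'] at e1 e2
  exact hw.adj.ne (hx.symm.trans (e2.trans e1.symm))

theorem le_one_div_of_agrees [Finite V] (hc : 2 ≤ c) (hγ : γ ∈ Set.Ioo (0 : ℝ) 1) {x w : V}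
    (hw : IsLeafAt G x w) {s₀ : State V c} {h : List (State V c)}
    (hh : NCHistory G s₀ h (gathered w x (Fin.last c))) {φ : Fin (c + 1) → PosProfile G c}
    (hφ : IsTriggerFamily γ 0 φ) (hagr : AgreesWithCROptimal γ 0 s₀ φ) : γ ≤ 1 / (c : ℝ) := by
  by_contra! hγc
  let m : Fin c := ⟨0, by omega⟩
  obtain ⟨σ, hσ, he⟩ := hagr (Fin.last c) m.castSucc
  have e := he _ _ hh rfl
  rw [(hφ m.castSucc).move_gathered hc hγ hγc hw rfl,
    (hσ.isGreedy hγ).move_gathered hw (by omega)] at e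
  exact hw.adj.ne e.symm

end Scar

namespace Scar

variable {V : Type*} {G : SimpleGraph V} {c : ℕ} {s : State V c} {n : ℕ} {γ : ℝ} {m : Fin c}

/-! ### Graphs on which the robber can escape -/

theorem exists_adj_dist_lt (hG : G.Connected) {u v : V} (h : u ≠ v) :
    ∃ u', G.Adj u u' ∧ G.dist u v = G.dist u' v + 1 := by
  obtain ⟨p, hp⟩ := hG.exists_walk_length_eq_dist u v
  cases p with
  | nil => exact absurd rfl h
  | cons hadj q =>
    refine ⟨_, hadj, ?_⟩
    have h1 := SimpleGraph.dist_le q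
    have h2 := hG.dist_triangle (u := u) (v := _) (w := v) |>.trans
      (Nat.add_le_add_right (SimpleGraph.dist_eq_one_iff_adj.2 hadj).le _)
    rw [SimpleGraph.Walk.length_cons] at hp
    omega

theorem Escapes.exists_robber_turn (d : ℕ) (s : State V c) (hd : s.turn.val + d = c)
    (he : Escapes G s) : Escapes G ⟨s.pos, Fin.last c⟩ := by
  induction d generalizing s with
  | zero =>
    have : s.turn = Fin.last c := Fin.ext (by simpa using hd)
    rw [← this]; exact he
  | succ d ih =>
    have hl : s.turn ≠ Fin.last c := ne_last_of_val_lt (by omega)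
    have h1 := he.step_of_mem hl (Legal.refl _)
    have h2 := ih _ (by rw [s.step_turn, val_add_one hl]; omega) h1
    rwa [State.step_stay] at h2

/-- In a position from which the robber can escape, he survives one round in which only cop `m`
moves. -/
theorem Escapes.round [Finite V] (he : Escapes G s) (ht : s.turn = m.castSucc) {v : V}
    (hv : Legal G (s.pos m.castSucc) v) : ∃ s' : State V c, Escapes G s' ∧ s'.turn = 0 ∧
      s'.pos m.castSucc = v ∧ Legal G s.robber s'.robber ∧ v ≠ s.robber ∧ v ≠ s'.robber := by
  have hml : m.castSucc ≠ Fin.last c := (Fin.castSucc_lt_last m).ne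
  have h1 : Escapes G (s.step v) := he.step_of_mem (by rw [ht]; exact hml) (by rwa [ht])
  have hv1 : (s.step v).pos m.castSucc = v := by rw [← ht, s.step_pos_turn]
  have hr1 : (s.step v).robber = s.robber := s.step_robber_of_ne v (ht ▸ hml)
  have h2 := Escapes.exists_robber_turn (c - (s.step v).turn.val) _ (by omega) h1
  obtain ⟨u, hu, h3⟩ := h2.exists_of_notMem (by simp)
  have hv3 : ((⟨(s.step v).pos, Fin.last c⟩ : State V c).step u).pos m.castSucc = v := by
    rw [State.step_pos_of_ne _ _ hml, hv1]
  refine ⟨_, h3, by rw [State.step_turn]; simp, hv3, ?_, ?_, ?_⟩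
  · rw [State.step_robber _ _ rfl, ← hr1]; exact hu
  · intro h
    exact h1.not_target ⟨m, by rw [hv1, hr1, h]⟩
  · intro h
    exact h3.not_target ⟨m, hv3.trans h⟩

theorem Escapes.exists_turn_zero [Finite V] (he : Escapes G s) :
    ∃ s' : State V c, Escapes G s' ∧ s'.turn = 0 := by
  have h2 := Escapes.exists_robber_turn (c - s.turn.val) _ (by omega) he
  obtain ⟨u, -, h3⟩ := h2.exists_of_notMem (by simp)
  exact ⟨_, h3, by rw [State.step_turn]; simp⟩

/-- From a vertex adjacent to all others a single cop would capture in his next move. -/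
theorem Escapes.not_universal [Finite V] (he : Escapes G s) (hc : 0 < c) (b : V) :
    ∃ v, v ≠ b ∧ ¬ G.Adj b v := by
  by_contra! hb
  let m : Fin c := ⟨0, hc⟩
  obtain ⟨s₁, h₁, ht₁⟩ := he.exists_turn_zero
  obtain ⟨s₂, h₂, ht₂, hp₂, -⟩ := h₁.round (m := m) (v := b) ht₁ (by
    by_cases h : s₁.pos m.castSucc = b
    · exact Or.inl h.symm
    · exact Or.inr (hb _ h).symm)
  obtain ⟨s₃, -, -, -, -, h, -⟩ := h₂.round (m := m) (v := s₂.robber) ht₂ (by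
    rw [hp₂]
    by_cases h : s₂.robber = b
    · exact Or.inl h
    · exact Or.inr (hb _ h))
  exact h rfl

/-- Without branching, the graph is a path that starts at the leaf, and the distance from the leaf
is a coordinate on it. -/
theorem dist_injective_of_leaf (hG : G.Connected) {r w : V} (hw : IsLeafAt G r w)
    (hdeg : ∀ b y₁ y₂ y₃, G.Adj b y₁ → G.Adj b y₂ → G.Adj b y₃ → y₁ ≠ y₂ → y₁ ≠ y₃ → y₂ = y₃)
    (k : ℕ) (u v : V) (hu : G.dist u r = k) (hv : G.dist v r = k) : u = v := by
  induction k generalizing u v with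
  | zero => rw [hG.dist_eq_zero_iff.1 hu, hG.dist_eq_zero_iff.1 hv]
  | succ k ih =>
    obtain ⟨u', hu', hu''⟩ := exists_adj_dist_lt hG (u := u) (v := r)
      (by rintro rfl; simp at hu)
    obtain ⟨v', hv', hv''⟩ := exists_adj_dist_lt hG (u := v) (v := r)
      (by rintro rfl; simp at hv)
    obtain rfl := ih u' v' (by omega) (by omega)
    by_cases hr : u' = r
    · subst hr
      rw [(hw u).1 hu'.symm, (hw v).1 hv'.symm]
    · obtain ⟨t, ht, ht'⟩ := exists_adj_dist_lt hG hr
      exact hdeg u' t u v ht hu'.symm hv'.symm (by rintro rfl; omega) (by rintro rfl; omega)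

theorem exists_dist_eq (hG : G.Connected) {r q : V} {l : ℕ} (h : l < G.dist q r) :
    ∃ u v, G.Adj u v ∧ G.dist u r = l ∧ G.dist v r = l + 1 := by
  induction hk : G.dist q r generalizing q with
  | zero => omega
  | succ k ih =>
    obtain ⟨q', hq, hq'⟩ := exists_adj_dist_lt hG (u := q) (v := r) (by rintro rfl; simp at hk)
    by_cases hl : l = k
    · exact ⟨q', q, hq.symm, by omega, by omega⟩
    · exact ih (q := q') (by omega) (by omega)

/-- A graph with a leaf on which the robber can escape is not a path. -/
theorem Escapes.exists_branching [Finite V] (he : Escapes G s) (hc : 0 < c) (hG : G.Connected)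
    {r w : V} (hw : IsLeafAt G r w) : ∃ b y₁ y₂ y₃, G.Adj b y₁ ∧ G.Adj b y₂ ∧ G.Adj b y₃ ∧
      y₁ ≠ y₂ ∧ y₁ ≠ y₃ ∧ y₂ ≠ y₃ := by
  by_contra! hdeg
  have hinj := dist_injective_of_leaf hG hw hdeg
  let m : Fin c := ⟨0, hc⟩
  -- A single cop walks to the end `r` of the path, which leaves the robber on his far side.
  have start : ∀ (k : ℕ) (s : State V c), Escapes G s → s.turn = 0 →
      G.dist (s.pos m.castSucc) r = k → ∃ s' : State V c, Escapes G s' ∧ s'.turn = 0 ∧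
        G.dist (s'.pos m.castSucc) r < G.dist s'.robber r := by
    intro k
    induction k with
    | zero =>
      intro s hs ht hk
      refine ⟨s, hs, ht, ?_⟩
      rw [hk, Nat.pos_iff_ne_zero]
      intro h0
      exact hs.not_target ⟨m, hinj 0 _ _ hk h0⟩
    | succ k ih =>
      intro s hs ht hk
      obtain ⟨v, hv, hv'⟩ := exists_adj_dist_lt hG (u := s.pos m.castSucc) (v := r)
        (by intro h; rw [h] at hk; simp at hk)
      obtain ⟨s', hs', ht', hp', -⟩ := hs.round (m := m) ht (Or.inr hv)
      exact ih s' hs' ht' (by rw [hp']; omega)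
  -- He then drives the robber outwards. The robber cannot jump over him, so the distance from `r`
  -- would grow without bound.
  have push : ∀ l : ℕ, ∃ s' : State V c, Escapes G s' ∧ s'.turn = 0 ∧
      l ≤ G.dist (s'.pos m.castSucc) r ∧
        G.dist (s'.pos m.castSucc) r < G.dist s'.robber r := by
    intro l
    induction l with
    | zero =>
      obtain ⟨s₁, h₁, ht₁⟩ := he.exists_turn_zero
      obtain ⟨s', h1, h2, h3⟩ := start _ s₁ h₁ ht₁ rfl
      exact ⟨s', h1, h2, Nat.zero_le _, h3⟩
    | succ l ih =>
      obtain ⟨s', h1, h2, h3, h4⟩ := ih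
      obtain ⟨u, v, huv, hu, hv⟩ := exists_dist_eq hG h4
      obtain rfl := hinj _ _ _ hu rfl
      obtain ⟨s₂, e1, e2, e3, e4, e5, e6⟩ := h1.round (m := m) h2 (Or.inr huv)
      refine ⟨s₂, e1, e2, by rw [e3]; omega, ?_⟩
      rw [e3]
      have f1 : G.dist v r ≠ G.dist s'.robber r := fun h => e5 (hinj _ _ _ h rfl)
      have f2 : G.dist v r ≠ G.dist s₂.robber r := fun h => e6 (hinj _ _ _ h rfl)
      have f3 : G.dist s'.robber r ≤ G.dist s₂.robber r + 1 := by
        rcases e4 with h | h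
        · rw [h]; omega
        · have := hG.dist_triangle (u := s'.robber) (v := s₂.robber) (w := r)
          rw [SimpleGraph.dist_eq_one_iff_adj.2 h] at this
          omega
      omega
  obtain ⟨M, hM⟩ := (Set.finite_range fun v => G.dist v r).bddAbove
  obtain ⟨s', -, -, h3, -⟩ := push (M + 1)
  have := hM ⟨s'.pos m.castSucc, rfl⟩
  simp only at this
  omega

end Scar

namespace Scar

variable {V : Type*} {G : SimpleGraph V} {c : ℕ}

/-! ### Positions that can be reached without capture -/

/-- One token moves, without capture. A configuration consists of the positions of the cops and of
the robber. -/
def ConfigStep (G : SimpleGraph V) (a b : (Fin c → V) × V) : Prop :=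
  (∃ i v, G.Adj (a.1 i) v ∧ v ≠ a.2 ∧ b = (Function.update a.1 i v, a.2)) ∨
  (∃ v, G.Adj a.2 v ∧ (∀ i, a.1 i ≠ v) ∧ b = (a.1, v))

/-- A configuration can be turned into another one by moves without capture. -/
abbrev Reaches (G : SimpleGraph V) : (Fin c → V) × V → (Fin c → V) × V → Prop :=
  Relation.ReflTransGen (ConfigStep G)

/-- There is a walk between two vertices that does not visit `x` after its start. -/
abbrev Bypasses (G : SimpleGraph V) (x : V) : V → V → Prop :=
  Relation.ReflTransGen fun a b => G.Adj a b ∧ b ≠ x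

theorem Bypasses.single {x u v : V} (h : G.Adj u v) (hv : v ≠ x) : Bypasses G x u v :=
  Relation.ReflTransGen.single ⟨h, hv⟩

variable {p f : Fin c → V} {x v : V}

theorem reaches_of_cop {i : Fin c} (h : Bypasses G x (p i) v) :
    Reaches G (p, x) (Function.update p i v, x) := by
  induction h with
  | refl => rw [Function.update_eq_self]
  | @tail u v _ hv ih =>
    refine ih.tail (Or.inl ⟨i, v, ?_, hv.2, ?_⟩)
    · simpa using hv.1
    · simp

theorem reaches_of_cops (h : ∀ i, Bypasses G x (p i) (f i)) : Reaches G (p, x) (f, x) := by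
  classical
  have key : ∀ S : Finset (Fin c), Reaches G (p, x) (fun i => if i ∈ S then f i else p i, x) := by
    intro S
    induction S using Finset.induction_on with
    | empty => simpa using Relation.ReflTransGen.refl
    | insert j S hj ih =>
      refine ih.trans ?_
      convert reaches_of_cop (p := fun i => if i ∈ S then f i else p i) (i := j) (v := f j) ?_
        using 2
      · ext i
        by_cases hij : i = j
        · subst hij; simp
        · simp [hij]
      · simpa [hj] using h j
  simpa using key Finset.univ

theorem reaches_of_robber (h : G.Adj x v) (hp : ∀ i, p i ≠ v) : Reaches G (p, x) (p, v) :=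
  Relation.ReflTransGen.single (Or.inr ⟨v, h, hp, rfl⟩)

theorem reaches_of_robber_walk {b y : V} (hy : Bypasses G b x y) :
    Reaches G ((fun _ => b : Fin c → V), x) (fun _ => b, y) := by
  induction hy with
  | refl => exact Relation.ReflTransGen.refl
  | tail _ h ih => exact ih.trans (reaches_of_robber h.1 fun _ => h.2.symm)

/-- The vertex `b` has three neighbours. -/
def IsBranching (G : SimpleGraph V) (b : V) : Prop :=
  ∃ y₁ y₂ y₃, G.Adj b y₁ ∧ G.Adj b y₂ ∧ G.Adj b y₃ ∧ y₁ ≠ y₂ ∧ y₁ ≠ y₃ ∧ y₂ ≠ y₃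

theorem IsBranching.exists_adj {b : V} (hb : IsBranching G b) (u v : V) :
    ∃ y, G.Adj b y ∧ y ≠ u ∧ y ≠ v := by
  obtain ⟨y₁, y₂, y₃, h₁, h₂, h₃, h₁₂, h₁₃, h₂₃⟩ := hb
  by_contra! h
  have e₁ := h y₁ h₁
  have e₂ := h y₂ h₂
  have e₃ := h y₃ h₃
  by_cases f₁ : y₁ = u
  · exact h₂₃ ((e₂ fun f => h₁₂ (f₁.trans f.symm)).trans (e₃ fun f => h₁₃ (f₁.trans f.symm)).symm)
  · by_cases f₂ : y₂ = u
    · exact h₁₃ ((e₁ f₁).trans (e₃ fun f => h₂₃ (f₂.trans f.symm)).symm)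
    · exact h₁₂ ((e₁ f₁).trans (e₂ f₂).symm)

/-- The robber can get to a branching vertex. -/
theorem exists_reaches_branching (hG : G.Connected) {b : V} (hb : IsBranching G b) (k : ℕ)
    (p : Fin c → V) (x : V) (hp : ∀ i, p i ≠ x) (hk : G.dist x b = k) :
    ∃ p', Reaches G (p, x) (p', b) ∧ ∀ i, p' i ≠ b := by
  classical
  induction k generalizing p x with
  | zero =>
    rw [hG.dist_eq_zero_iff] at hk
    subst hk
    exact ⟨p, Relation.ReflTransGen.refl, hp⟩
  | succ k ih =>
    obtain ⟨x', hx, hx'⟩ := exists_adj_dist_lt hG (u := x) (v := b) (by rintro rfl; simp at hk)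
    -- Cops that block the next vertex `x'` step aside to `z`.
    obtain ⟨z, hz, hzx⟩ : ∃ z, G.Adj x' z ∧ z ≠ x := by
      by_cases h : x' = b
      · subst h
        obtain ⟨y, h1, h2, -⟩ := hb.exists_adj x x
        exact ⟨y, h1, h2⟩
      · obtain ⟨z, hz, hz'⟩ := exists_adj_dist_lt hG h
        exact ⟨z, hz, by rintro rfl; omega⟩
    have h1 : Reaches G (p, x) (fun i => if p i = x' then z else p i, x) := by
      refine reaches_of_cops fun i => ?_
      split_ifs with h
      · rw [h]; exact Bypasses.single hz hzx
      · exact Relation.ReflTransGen.refl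
    have hne : ∀ i, (if p i = x' then z else p i) ≠ x' := by
      intro i
      split_ifs with h
      · exact hz.ne'
      · exact h
    obtain ⟨p', h2, h3⟩ := ih _ x' hne (by omega)
    exact ⟨p', (h1.trans (reaches_of_robber hx hne)).trans h2, h3⟩

/-- All cops can gather at a branching vertex from which not every vertex is visible. -/
theorem exists_reaches_gathered (hG : G.Connected) {b : V} (hb : IsBranching G b)
    (hu : ∃ v, v ≠ b ∧ ¬ G.Adj b v) (hp : ∀ i, p i ≠ b) :
    ∃ y, G.Adj b y ∧ Reaches G (p, b) (fun _ => b, y) := by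
  classical
  -- If no neighbour of `b` led further, `b` and its neighbours would be the whole graph.
  obtain ⟨y₁, hy₁, z, hz, hzb⟩ : ∃ y₁, G.Adj b y₁ ∧ ∃ z, G.Adj y₁ z ∧ z ≠ b := by
    by_contra! hno
    obtain ⟨u, hub, hu⟩ := hu
    rcases mem_of_connected hG (S := {v | v = b ∨ G.Adj b v}) (Or.inl rfl) (by
      rintro a (rfl | ha) v hv
      · exact Or.inr hv
      · exact Or.inl (hno a ha v hv)) u with h | h
    · exact hub h
    · exact hu h
  obtain ⟨y₂, hy₂, h₂₁, -⟩ := hb.exists_adj y₁ y₁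
  obtain ⟨y₃, hy₃, h₃₁, h₃₂⟩ := hb.exists_adj y₁ y₂
  let p₁ : Fin c → V := fun i => if p i = y₁ then z else p i
  have hp₁ : ∀ i, p₁ i ≠ y₁ := by
    intro i
    simp only [p₁]
    split_ifs with h
    · exact hz.ne'
    · exact h
  have r₁ : Reaches G (p, b) (p₁, b) := by
    refine reaches_of_cops fun i => ?_
    simp only [p₁]
    split_ifs with h
    · rw [h]; exact Bypasses.single hz hzb
    · exact Relation.ReflTransGen.refl
  have r₂ : Reaches G (p₁, b) (p₁, y₁) := reaches_of_robber hy₁ hp₁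
  -- While the robber waits in `y₁`, the cops that can get to `b` without passing him are parked at
  -- `y₂`. The others come later through `y₁`, with the robber in `y₃`.
  let p₂ : Fin c → V := fun i => if Bypasses G y₁ (p₁ i) b then y₂ else p₁ i
  have r₃ : Reaches G (p₁, y₁) (p₂, y₁) := by
    refine reaches_of_cops fun i => ?_
    simp only [p₂]
    split_ifs with h
    · exact h.trans (Bypasses.single hy₂ h₂₁)
    · exact Relation.ReflTransGen.refl
  have r₄ : Reaches G (p₂, y₁) (p₂, b) := by
    refine reaches_of_robber hy₁.symm fun i => ?_
    simp only [p₂]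
    split_ifs with h
    · exact hy₂.ne'
    · intro h'; rw [h'] at h; exact h Relation.ReflTransGen.refl
  have r₅ : Reaches G (p₂, b) (p₂, y₃) := by
    refine reaches_of_robber hy₃ fun i => ?_
    simp only [p₂]
    split_ifs with h
    · exact h₃₂.symm
    · intro h'; rw [h'] at h; exact h (Bypasses.single hy₃.symm hy₁.ne)
  -- A shortest path from such a `u` to `b` must meet `y₁`. It does not meet `y₃` before, as `y₃` is
  -- adjacent to `b`.
  have detour : ∀ k u, G.dist u b = k → ¬ Bypasses G y₁ u b → Bypasses G y₃ u y₁ := by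
    intro k
    induction k with
    | zero =>
      intro u hk hu
      rw [hG.dist_eq_zero_iff.1 hk] at hu
      exact absurd Relation.ReflTransGen.refl hu
    | succ k ih =>
      intro u hk hu
      obtain ⟨u', hadj, hu'⟩ := exists_adj_dist_lt hG (u := u) (v := b)
        (by rintro rfl; simp at hk)
      by_cases h : u' = y₁
      · rw [h] at hadj; exact Bypasses.single hadj h₃₁.symm
      · have hno : ¬ Bypasses G y₁ u' b := fun hb => hu (Relation.ReflTransGen.head ⟨hadj, h⟩ hb)
        have hne : u' ≠ y₃ := by
          rintro rfl
          exact hno (Bypasses.single hy₃.symm hy₁.ne)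
        exact Relation.ReflTransGen.head ⟨hadj, hne⟩ (ih u' (by omega) hno)
  have r₆ : Reaches G (p₂, y₃) (fun _ => b, y₃) := by
    refine reaches_of_cops fun i => ?_
    simp only [p₂]
    split_ifs with h
    · exact Bypasses.single hy₂.symm hy₃.ne
    · exact (detour _ _ rfl h).tail ⟨hy₁.symm, hy₃.ne⟩
  exact ⟨y₃, hy₃, ((((r₁.trans r₂).trans r₃).trans r₄).trans r₅).trans r₆⟩

/-- The cops step aside to a third neighbour of `b` while the robber crosses. -/
theorem reaches_swap {b y y' : V} (hb : IsBranching G b) (hy : G.Adj b y) (hy' : G.Adj b y') :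
    Reaches G ((fun _ => b : Fin c → V), y) (fun _ => b, y') := by
  obtain ⟨z, hz, hzy, hzy'⟩ := hb.exists_adj y y'
  have r₁ : Reaches G ((fun _ => b : Fin c → V), y) (fun _ => z, y) :=
    reaches_of_cops fun _ => Bypasses.single hz hzy
  have r₂ : Reaches G ((fun _ => z : Fin c → V), y) (fun _ => z, b) :=
    reaches_of_robber hy.symm fun _ => hz.ne'
  have r₃ : Reaches G ((fun _ => z : Fin c → V), b) (fun _ => z, y') :=
    reaches_of_robber hy' fun _ => hzy'
  have r₄ : Reaches G ((fun _ => z : Fin c → V), y') (fun _ => b, y') :=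
    reaches_of_cops fun _ => Bypasses.single hz.symm hy'.ne
  exact ((r₁.trans r₂).trans r₃).trans r₄

theorem bypasses_of_dist_lt (hG : G.Connected) {b r : V} (k : ℕ) (v : V) (hk : G.dist v r = k)
    (h : k < G.dist b r) : Bypasses G b v r := by
  induction k generalizing v with
  | zero => rw [hG.dist_eq_zero_iff.1 hk]
  | succ k ih =>
    obtain ⟨v', hv, hv'⟩ := exists_adj_dist_lt hG (u := v) (v := r) (by rintro rfl; simp at hk)
    exact Relation.ReflTransGen.head ⟨hv, by rintro rfl; omega⟩ (ih v' (by omega) (by omega))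

theorem bypasses_leaf (hG : G.Connected) {r w : V} (hw : IsLeafAt G r w) (k : ℕ) (u : V)
    (hk : G.dist u w = k) (hu : u ≠ r) : Bypasses G r u w := by
  induction k generalizing u with
  | zero => rw [hG.dist_eq_zero_iff.1 hk]
  | succ k ih =>
    have huw : u ≠ w := by rintro rfl; simp at hk
    obtain ⟨u', hu1, hu'⟩ := exists_adj_dist_lt hG huw
    have hne : u' ≠ r := by
      rintro rfl
      exact huw ((hw u).1 hu1.symm)
    exact Relation.ReflTransGen.head ⟨hu1, hne⟩ (ih u' (by omega) hne)

/-- With the cops gathered at `b`, the robber is switched to the branch that leads to the leaf `r`.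
He walks there, and the cops follow to `w`. -/
theorem reaches_trap (hG : G.Connected) {b : V} (hb : IsBranching G b)
    (hu : ∃ v, v ≠ b ∧ ¬ G.Adj b v) {r w : V} (hw : IsLeafAt G r w) (hp : ∀ i, p i ≠ x) :
    Reaches G (p, x) (fun _ => w, r) := by
  obtain ⟨p', r₁, hp'⟩ := exists_reaches_branching hG hb _ p x hp rfl
  obtain ⟨y, hy, r₂⟩ := exists_reaches_gathered hG hb hu hp'
  have hbr : b ≠ r := by
    rintro rfl
    obtain ⟨z, hz, hzw, -⟩ := hb.exists_adj w w
    exact hzw ((hw z).1 hz)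
  obtain ⟨y', hy', hd⟩ := exists_adj_dist_lt hG hbr
  have r₃ := reaches_swap (c := c) hb hy hy'
  have r₄ : Reaches G ((fun _ => b : Fin c → V), y') (fun _ => b, r) :=
    reaches_of_robber_walk (bypasses_of_dist_lt hG _ y' rfl (by omega))
  have r₅ : Reaches G ((fun _ => b : Fin c → V), r) (fun _ => w, r) :=
    reaches_of_cops fun _ => bypasses_leaf hG hw _ b rfl hbr
  exact (((r₁.trans r₂).trans r₃).trans r₄).trans r₅

/-! ### From configurations to histories -/

/-- The state with the configuration `a` in which token `t` has the move. -/
def configState (a : (Fin c → V) × V) (t : Fin (c + 1)) : State V c :=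
  ⟨Fin.snoc (α := fun _ => V) a.1 a.2, t⟩

theorem configState_pos (a : (Fin c → V) × V) (t : Fin (c + 1)) (i : Fin c) :
    (configState a t).pos i.castSucc = a.1 i := by
  simp only [configState, Fin.snoc_castSucc]

theorem configState_robber (a : (Fin c → V) × V) (t : Fin (c + 1)) :
    (configState a t).robber = a.2 := by
  simp only [configState, State.robber, Fin.snoc_last]

theorem NCHistory.not_isCapture {s₀ s : State V c} {h : List (State V c)}
    (hh : NCHistory G s₀ h s) : ¬ s.IsCapture := by
  cases hh <;> assumption

/-- Tokens may pass, so the turn can be handed to anybody. Hence reachability is a question about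
configurations only. -/
theorem NCHistory.exists_turn {s₀ s : State V c} {h : List (State V c)} (hh : NCHistory G s₀ h s)
    (t : Fin (c + 1)) : ∃ h', NCHistory G s₀ h' ⟨s.pos, t⟩ := by
  have key : ∀ k : ℕ, ∃ h', NCHistory G s₀ h' ⟨s.pos, (fun i : Fin (c + 1) => i + 1)^[k] s.turn⟩ := by
    intro k
    induction k with
    | zero => exact ⟨h, hh⟩
    | succ k ih =>
      obtain ⟨h', hh'⟩ := ih
      rw [Function.iterate_succ_apply']
      have := hh'.move _ (Legal.refl _) (State.not_isCapture_stay hh'.not_isCapture)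
      rw [State.step_stay] at this
      exact ⟨_, this⟩
  have ht : (fun i : Fin (c + 1) => i + 1)^[t.val + (c + 1 - s.turn.val)] s.turn = t := by
    apply Fin.ext
    have := s.turn.isLt
    rw [iterate_add_one_val, show s.turn.val + (t.val + (c + 1 - s.turn.val)) = t.val + (c + 1) by
      omega, Nat.add_mod_right, Nat.mod_eq_of_lt t.isLt]
  rw [← ht]
  exact key _

theorem NCHistory.exists_of_reaches {s₀ : State V c} {a b : (Fin c → V) × V} (hab : Reaches G a b)
    {h : List (State V c)} {t : Fin (c + 1)} (hh : NCHistory G s₀ h (configState a t))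
    (t' : Fin (c + 1)) : ∃ h', NCHistory G s₀ h' (configState b t') := by
  induction hab generalizing t' with
  | refl => exact hh.exists_turn t'
  | @tail b d _ hbd ih =>
    rcases hbd with ⟨i, v, hv, hne, rfl⟩ | ⟨v, hv, hne, rfl⟩
    · obtain ⟨h₁, hh₁⟩ := ih i.castSucc
      have hstep : (configState b i.castSucc).step v =
          configState (Function.update b.1 i v, b.2) (i.castSucc + 1) := by
        simp only [State.step, configState, Fin.snoc_update]
      have hcap : ¬ ((configState b i.castSucc).step v).IsCapture := by
        rw [hstep]
        rintro ⟨j, hj⟩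
        rw [configState_pos, configState_robber] at hj
        by_cases hji : j = i
        · subst hji
          simp only [Function.update_self] at hj
          exact hne hj
        · simp only [Function.update_of_ne hji] at hj
          exact hh₁.not_isCapture ⟨j, by rw [configState_pos, configState_robber, hj]⟩
      have := hh₁.move v (Or.inr (by
        change G.Adj ((configState b i.castSucc).pos i.castSucc) v
        rw [configState_pos]; exact hv)) hcap
      rw [hstep] at this
      exact this.exists_turn t'
    · obtain ⟨h₁, hh₁⟩ := ih (Fin.last c)
      have hstep : (configState b (Fin.last c)).step v = configState (b.1, v) (Fin.last c + 1) := by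
        simp only [State.step, configState, Fin.update_snoc_last]
      have hcap : ¬ ((configState b (Fin.last c)).step v).IsCapture := by
        rw [hstep]
        rintro ⟨j, hj⟩
        rw [configState_pos, configState_robber] at hj
        exact hne j hj
      have := hh₁.move v (Or.inr (by
        change G.Adj (configState b (Fin.last c)).robber v
        rw [configState_robber]; exact hv)) hcap
      rw [hstep] at this
      exact this.exists_turn t'

theorem exists_history_gathered [Finite V] (hG : G.Connected) (hc : 0 < c) (hGc : ClassG G c)
    {r w : V} (hw : IsLeafAt G r w) {s₀ : State V c} (hs₀ : ¬ s₀.IsCapture) :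
    ∃ h, NCHistory G s₀ h (gathered w r (Fin.last c)) := by
  obtain ⟨s, hs, htop⟩ := hGc
  have he : Escapes G s := by
    by_contra he
    exact stateCopNumber_ne_top hc he htop
  obtain ⟨b, hb⟩ := he.exists_branching hc hG hw
  have hreach := reaches_trap (p := fun i : Fin c => s₀.pos i.castSucc) hG hb
    (he.not_universal hc b) hw (x := s₀.robber) (fun i hi => hs₀ ⟨i, hi⟩)
  have h0 : configState (fun i : Fin c => s₀.pos i.castSucc, s₀.robber) s₀.turn = s₀ := by
    ext k
    · induction k using Fin.lastCases with
      | last => exact configState_robber _ _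
      | cast i => exact configState_pos _ _ i
    · rfl
  refine NCHistory.exists_of_reaches (h := []) hreach (t := s₀.turn) ?_ (Fin.last c)
  rw [h0]
  exact NCHistory.start hs₀

end Scar

/-! ### The two equivalences -/

theorem mainTheorem10 {V : Type*} [Finite V] (G : SimpleGraph V) (hG : G.Connected)
    (c : ℕ) (hc : 2 ≤ c) (γ : ℝ) (hγ : γ ∈ Set.Ioo (0 : ℝ) 1)
    (hG3 : Scar.ClassG3 G c γ 0) (s₀ : Scar.State V c) (hs₀ : ¬ s₀.IsCapture) :
    ((∃ φ : Fin (c + 1) → Scar.PosProfile G c,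
        Scar.IsTriggerFamily γ 0 φ ∧ Scar.AgreesWithCROptimal γ 0 s₀ φ) ↔
      γ ∈ Set.Ioc (0 : ℝ) (1 / (c : ℝ))) ∧
    ((∃ φ : Fin (c + 1) → Scar.PosProfile G c,
        Scar.IsTriggerFamily γ 0 φ ∧ Scar.IsPositional (Scar.trigger φ)) ↔
      γ ∈ Set.Ioc (0 : ℝ) (1 / (c : ℝ))) := by
  obtain ⟨σ, hσ⟩ := Scar.exists_greedy_profile G c
  -- The witness is the constant family: each token plays the same greedy strategy before and after
  -- any deviation.
  refine ⟨⟨?_, fun h => ⟨fun _ => σ, ?_, ?_⟩⟩, ⟨?_, fun h => ⟨fun _ => σ, ?_, ?_⟩⟩⟩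
  · rintro ⟨φ, hφ, hagr⟩
    obtain ⟨x, w, hw⟩ := Scar.exists_leaf hG hc hγ hG3
    obtain ⟨h, hh⟩ := Scar.exists_history_gathered hG (by omega) hG3.1.1.1 hw hs₀
    exact ⟨hγ.1, Scar.le_one_div_of_agrees hc hγ hw hh hφ hagr⟩
  · exact fun m => Scar.isOptimalProfile_of_greedy hG hc hγ h.2 hG3 hσ m
  · exact fun n _ => ⟨σ n, ⟨σ, Scar.isOptimalProfile_last_of_greedy hγ hσ, rfl⟩, fun _ _ _ _ => rfl⟩
  · rintro ⟨φ, hφ, hpos⟩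
    exact ⟨hγ.1, Scar.le_one_div_of_isPositional hG hc hγ hG3 hφ hpos⟩
  · exact fun m => Scar.isOptimalProfile_of_greedy hG hc hγ h.2 hG3 hσ m
  · exact fun n => ⟨(σ n).move, fun _ _ _ _ _ => rfl⟩
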